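/- Let $\mathbb F\in\{\mathbb R,\mathbb C,\mathbb H\}$ and $c=\dim_{\mathbb R}\mathbb F$. Let $(X,A)$ be a relative CW-complex of dimension at most $d$, where $d\ge 0$ is an integer; that is, $X$ is built from a closed subspace $A\subseteq X$ by successively attaching cells of dimension at most $d$. An $\mathbb F$-vector bundle is a locally trivial bundle of finite-dimensional $\mathbb F$-vector spaces, whose rank may differ between connected components; vector bundle maps and isomorphisms cover the identity of the base and are continuous and $\mathbb F$-linear on fibres, and a vector bundle map is injective if it is injective on each fibre. (1) Let $V$ and $E$ be $\mathbb F$-vector bundles over $X$ and let $\iota\colon V|_A\to E|_A$ be an injective $\mathbb F$-vector bundle map. Assume that $$\dim_{\mathbb F}E_x\ \ge\ \dim_{\mathbb F}V_x+\left\lceil\frac{d+1-c}{c}\right\rceil$$ for all $x\in X\setminus A$ with $V_x\ne 0$. Then $\iota$ extends to an injective $\mathbb F$-vector bundle map $V\to E$. (2) Let $V$, $E_1$ and $E_2$ be $\mathbb F$-vector bundles over $X$. Let $\varphi_A\colon E_1|_A\to E_2|_A$ and $\varphi_V\colon E_1\oplus V\to E_2\oplus V$ be $\mathbb F$-vector bundle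 isomorphisms such that $\varphi_V|_A=\varphi_A\oplus\mathrm{Id}_{V|_A}$. Assume that $$\dim_{\mathbb F}(E_1)_x\ \ge\ \left\lceil\frac{d+2-c}{c}\right\rceil$$ for all $x\in X\setminus A$ with $V_x\ne 0$. Then there is an $\mathbb F$-vector bundle isomorphism $\varphi\colon E_1\to E_2$ such that $\varphi|_A=\varphi_A$. -/

import Mathlib

open CategoryTheory Bundle

universe u v v₁ v₂ v₃ w

noncomputable section

/-!
Topological vector bundles over a (possibly noncommutative) finite-dimensional real division
algebra `𝔽`. The rank may vary from one connected component of the base to another. For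
noncommutative `𝔽` the fibres are left `𝔽`-vector spaces.

In the theorem `𝔽` is a finite-dimensional normed division algebra over `ℝ`; up to isomorphism these
are exactly `ℝ`, `ℂ` and the quaternions `ℍ[ℝ]`, which all carry the required instances in Mathlib.
-/

/-- An `𝔽`-vector bundle over `X`: a family of (left) `𝔽`-vector spaces `Fiber x`, together with a
topology on the total space such that the projection to `X` is continuous and such that every point
of `X` has an open neighbourhood `U` over which the total space is homeomorphic to `U × 𝔽ⁿ` for some
`n`, by a homeomorphism over `U` that is `𝔽`-linear on fibres. -/
structure FVectorBundle (𝔽 : Type w) [NormedDivisionRing 𝔽] (X : Type u) [TopologicalSpace X] where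
  /-- The fibres. -/
  Fiber : X → Type v
  [addCommGroup : ∀ x, AddCommGroup (Fiber x)]
  [module : ∀ x, Module 𝔽 (Fiber x)]
  /-- The topology on the total space. -/
  [topology : TopologicalSpace (TotalSpace 𝔽 Fiber)]
  continuous_proj : Continuous (fun p : TotalSpace 𝔽 Fiber => p.proj)
  locally_trivial : ∀ x : X, ∃ (U : Set X) (n : ℕ) (φ : ∀ b : U, Fiber b ≃ₗ[𝔽] (Fin n → 𝔽)),
    IsOpen U ∧ x ∈ U ∧
      IsHomeomorph (fun p : {p : TotalSpace 𝔽 Fiber // p.proj ∈ U} =>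
        ((⟨p.1.proj, p.2⟩, φ ⟨p.1.proj, p.2⟩ p.1.snd) : U × (Fin n → 𝔽)))

namespace FVectorBundle

attribute [instance] FVectorBundle.addCommGroup FVectorBundle.module FVectorBundle.topology

variable {𝔽 : Type w} [NormedDivisionRing 𝔽] {X : Type u} [TopologicalSpace X]

/-- The total space of a vector bundle. -/
abbrev Total (E : FVectorBundle.{u, v} 𝔽 X) : Type (max u v) := TotalSpace 𝔽 E.Fiber

/-- The restriction `E|_A` of a vector bundle to a subspace `A` of the base; its total space carries
the subspace topology. -/
def restrict (E : FVectorBundle.{u, v} 𝔽 X) (A : Set X) : FVectorBundle.{u, v} 𝔽 A where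
  Fiber a := E.Fiber a
  topology := TopologicalSpace.induced
    (fun p => (⟨p.proj.1, p.snd⟩ : TotalSpace 𝔽 E.Fiber)) E.topology
  continuous_proj := by
    let _ : TopologicalSpace (TotalSpace 𝔽 fun a : A => E.Fiber a) := TopologicalSpace.induced
      (fun p => (⟨p.proj.1, p.snd⟩ : TotalSpace 𝔽 E.Fiber)) E.topology
    have h : Continuous (fun p : TotalSpace 𝔽 (fun a : A => E.Fiber a) =>
      (⟨p.proj.1, p.snd⟩ : TotalSpace 𝔽 E.Fiber)) := continuous_induced_dom
    exact Continuous.subtype_mk (E.continuous_proj.comp h) _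
  locally_trivial := by
    let _ : TopologicalSpace (TotalSpace 𝔽 fun a : A => E.Fiber a) := TopologicalSpace.induced
      (fun p => (⟨p.proj.1, p.snd⟩ : TotalSpace 𝔽 E.Fiber)) E.topology
    have hj : Continuous (fun p : TotalSpace 𝔽 (fun a : A => E.Fiber a) =>
      (⟨p.proj.1, p.snd⟩ : TotalSpace 𝔽 E.Fiber)) := continuous_induced_dom
    have hp : Continuous (fun p : TotalSpace 𝔽 (fun a : A => E.Fiber a) => p.proj) :=
      Continuous.subtype_mk (E.continuous_proj.comp hj) _
    intro a
    obtain ⟨U, n, φ, hU, ha, hφ⟩ := E.locally_trivial a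
    refine ⟨Subtype.val ⁻¹' U, n, fun b => φ ⟨b.1.1, b.2⟩, hU.preimage continuous_subtype_val,
      ha, ?_⟩
    let H := hφ.homeomorph _
    have hinv : ∀ q : U × (Fin n → 𝔽),
        H.symm q = ⟨⟨q.1.1, (φ q.1).symm q.2⟩, q.1.2⟩ := by
      intro q
      rw [Homeomorph.symm_apply_eq]
      change q = (⟨q.1.1, q.1.2⟩, φ q.1 ((φ q.1).symm q.2))
      simp
    refine Homeomorph.isHomeomorph (X := {p : TotalSpace 𝔽 (fun a : A => E.Fiber a) //
        p.proj ∈ Subtype.val ⁻¹' U}) (Y := (Subtype.val ⁻¹' U : Set A) × (Fin n → 𝔽))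
      { toFun := fun p => (⟨p.1.proj, p.2⟩, φ ⟨p.1.proj.1, p.2⟩ p.1.snd)
        invFun := fun q => ⟨⟨q.1.1, (φ ⟨q.1.1.1, q.1.2⟩).symm q.2⟩, q.1.2⟩
        left_inv := fun p => by simp
        right_inv := fun q => by simp
        continuous_toFun := ?_
        continuous_invFun := ?_ }
    · refine Continuous.prodMk (Continuous.subtype_mk (hp.comp continuous_subtype_val) _) ?_
      have h1 : Continuous (fun p : {p : TotalSpace 𝔽 (fun a : A => E.Fiber a) //
          p.proj ∈ Subtype.val ⁻¹' U} =>
          (⟨⟨p.1.proj.1, p.1.snd⟩, p.2⟩ : {p : TotalSpace 𝔽 E.Fiber // p.proj ∈ U})) :=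
        Continuous.subtype_mk (hj.comp continuous_subtype_val) _
      exact continuous_snd.comp (hφ.continuous.comp h1)
    · refine Continuous.subtype_mk (continuous_induced_rng.2 ?_) _
      have h1 : Continuous (fun q : (Subtype.val ⁻¹' U : Set A) × (Fin n → 𝔽) =>
          ((⟨q.1.1.1, q.1.2⟩, q.2) : U × (Fin n → 𝔽))) := by fun_prop
      have h2 := continuous_subtype_val.comp (H.symm.continuous.comp h1)
      refine h2.congr fun q => ?_
      simp [hinv]

/-- The direct sum (Whitney sum) of two vector bundles; its total space is topologised as the fibre
product over `X` of the two total spaces. -/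
def directSum (E : FVectorBundle.{u, v₁} 𝔽 X) (F : FVectorBundle.{u, v₂} 𝔽 X) :
    FVectorBundle.{u, max v₁ v₂} 𝔽 X where
  Fiber x := E.Fiber x × F.Fiber x
  topology := TopologicalSpace.induced
    (fun p => ((⟨p.proj, p.snd.1⟩, ⟨p.proj, p.snd.2⟩) : E.Total × F.Total)) inferInstance
  continuous_proj := by
    let _ : TopologicalSpace (TotalSpace 𝔽 fun x => E.Fiber x × F.Fiber x) :=
      TopologicalSpace.induced
        (fun p => ((⟨p.proj, p.snd.1⟩, ⟨p.proj, p.snd.2⟩) : E.Total × F.Total)) inferInstance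
    have h : Continuous (fun p : TotalSpace 𝔽 (fun x => E.Fiber x × F.Fiber x) =>
      ((⟨p.proj, p.snd.1⟩, ⟨p.proj, p.snd.2⟩) : E.Total × F.Total)) := continuous_induced_dom
    exact E.continuous_proj.comp (continuous_fst.comp h)
  locally_trivial := by
    let _ : TopologicalSpace (TotalSpace 𝔽 fun x => E.Fiber x × F.Fiber x) :=
      TopologicalSpace.induced
        (fun p => ((⟨p.proj, p.snd.1⟩, ⟨p.proj, p.snd.2⟩) : E.Total × F.Total)) inferInstance
    have hj : Continuous (fun p : TotalSpace 𝔽 (fun x => E.Fiber x × F.Fiber x) =>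
      ((⟨p.proj, p.snd.1⟩, ⟨p.proj, p.snd.2⟩) : E.Total × F.Total)) := continuous_induced_dom
    have hp : Continuous (fun p : TotalSpace 𝔽 (fun x => E.Fiber x × F.Fiber x) => p.proj) :=
      E.continuous_proj.comp (continuous_fst.comp hj)
    intro x
    obtain ⟨U, n, φ, hU, hxU, hφ⟩ := E.locally_trivial x
    obtain ⟨W, m, ψ, hW, hxW, hψ⟩ := F.locally_trivial x
    let s : ((Fin n → 𝔽) × (Fin m → 𝔽)) ≃ₗ[𝔽] (Fin (n + m) → 𝔽) :=
      (LinearEquiv.sumArrowLequivProdArrow (Fin n) (Fin m) 𝔽 𝔽).symm.trans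
        (LinearEquiv.funCongrLeft 𝔽 𝔽 finSumFinEquiv.symm)
    have hs : Continuous s := by
      refine continuous_pi fun i => ?_
      change Continuous fun q : (Fin n → 𝔽) × (Fin m → 𝔽) =>
        Sum.elim q.1 q.2 (finSumFinEquiv.symm i)
      rcases finSumFinEquiv.symm i with j | j
      · exact (continuous_apply j).comp continuous_fst
      · exact (continuous_apply j).comp continuous_snd
    have hs' : Continuous s.symm := by
      refine Continuous.prodMk (continuous_pi fun i => ?_) (continuous_pi fun i => ?_)
      · exact continuous_apply (finSumFinEquiv (Sum.inl i))
      · exact continuous_apply (finSumFinEquiv (Sum.inr i))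
    refine ⟨U ∩ W, n + m,
      fun b => (LinearEquiv.prodCongr (φ ⟨b.1, b.2.1⟩) (ψ ⟨b.1, b.2.2⟩)).trans s,
      hU.inter hW, ⟨hxU, hxW⟩, ?_⟩
    let H := hφ.homeomorph _
    let K := hψ.homeomorph _
    have hHinv : ∀ q : U × (Fin n → 𝔽),
        H.symm q = ⟨⟨q.1.1, (φ q.1).symm q.2⟩, q.1.2⟩ := by
      intro q
      rw [Homeomorph.symm_apply_eq]
      change q = (⟨q.1.1, q.1.2⟩, φ q.1 ((φ q.1).symm q.2))
      simp
    have hKinv : ∀ q : W × (Fin m → 𝔽),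
        K.symm q = ⟨⟨q.1.1, (ψ q.1).symm q.2⟩, q.1.2⟩ := by
      intro q
      rw [Homeomorph.symm_apply_eq]
      change q = (⟨q.1.1, q.1.2⟩, ψ q.1 ((ψ q.1).symm q.2))
      simp
    refine Homeomorph.isHomeomorph (X := {p : TotalSpace 𝔽 (fun x => E.Fiber x × F.Fiber x) //
        p.proj ∈ U ∩ W}) (Y := (U ∩ W : Set X) × (Fin (n + m) → 𝔽))
      { toFun := fun p => (⟨p.1.proj, p.2⟩,
          s (φ ⟨p.1.proj, p.2.1⟩ p.1.snd.1, ψ ⟨p.1.proj, p.2.2⟩ p.1.snd.2))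
        invFun := fun q => ⟨⟨q.1.1, ((φ ⟨q.1.1, q.1.2.1⟩).symm (s.symm q.2).1,
          (ψ ⟨q.1.1, q.1.2.2⟩).symm (s.symm q.2).2)⟩, q.1.2⟩
        left_inv := fun p => by simp
        right_inv := fun q => by simp
        continuous_toFun := ?_
        continuous_invFun := ?_ }
    · refine Continuous.prodMk (Continuous.subtype_mk (hp.comp continuous_subtype_val) _)
        (hs.comp (Continuous.prodMk ?_ ?_))
      · have h1 : Continuous (fun p : {p : TotalSpace 𝔽 (fun x => E.Fiber x × F.Fiber x) //
            p.proj ∈ U ∩ W} =>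
            (⟨⟨p.1.proj, p.1.snd.1⟩, p.2.1⟩ : {p : TotalSpace 𝔽 E.Fiber // p.proj ∈ U})) :=
          Continuous.subtype_mk ((continuous_fst.comp hj).comp continuous_subtype_val) _
        exact continuous_snd.comp (hφ.continuous.comp h1)
      · have h1 : Continuous (fun p : {p : TotalSpace 𝔽 (fun x => E.Fiber x × F.Fiber x) //
            p.proj ∈ U ∩ W} =>
            (⟨⟨p.1.proj, p.1.snd.2⟩, p.2.2⟩ : {p : TotalSpace 𝔽 F.Fiber // p.proj ∈ W})) :=
          Continuous.subtype_mk ((continuous_snd.comp hj).comp continuous_subtype_val) _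
        exact continuous_snd.comp (hψ.continuous.comp h1)
    · refine Continuous.subtype_mk (continuous_induced_rng.2 ?_) _
      refine Continuous.prodMk (X := E.Total) (Y := F.Total)
        (f := fun q : (U ∩ W : Set X) × (Fin (n + m) → 𝔽) =>
          ⟨q.1.1, (φ ⟨q.1.1, q.1.2.1⟩).symm (s.symm q.2).1⟩)
        (g := fun q : (U ∩ W : Set X) × (Fin (n + m) → 𝔽) =>
          ⟨q.1.1, (ψ ⟨q.1.1, q.1.2.2⟩).symm (s.symm q.2).2⟩) ?_ ?_
      · have h1 : Continuous (fun q : (U ∩ W : Set X) × (Fin (n + m) → 𝔽) =>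
            ((⟨q.1.1, q.1.2.1⟩, (s.symm q.2).1) : U × (Fin n → 𝔽))) := by fun_prop
        have h2 := continuous_subtype_val.comp (H.symm.continuous.comp h1)
        refine h2.congr fun q => ?_
        simp [hHinv]
      · have h1 : Continuous (fun q : (U ∩ W : Set X) × (Fin (n + m) → 𝔽) =>
            ((⟨q.1.1, q.1.2.2⟩, (s.symm q.2).2) : W × (Fin m → 𝔽))) := by fun_prop
        have h2 := continuous_subtype_val.comp (K.symm.continuous.comp h1)
        refine h2.congr fun q => ?_
        simp [hKinv]

/-- A vector bundle map over the identity of `X`: a family of `𝔽`-linear maps between the fibres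
that is continuous as a map of total spaces. -/
structure Hom (V : FVectorBundle.{u, v₁} 𝔽 X) (E : FVectorBundle.{u, v₂} 𝔽 X) where
  /-- The linear maps on fibres. -/
  onFiber : ∀ x, V.Fiber x →ₗ[𝔽] E.Fiber x
  continuous_total : Continuous (fun p : V.Total => (⟨p.proj, onFiber p.proj p.snd⟩ : E.Total))

/-- A vector bundle map is injective if it is injective on each fibre (equivalently, on the total
space). -/
def Hom.Injective {V : FVectorBundle.{u, v₁} 𝔽 X} {E : FVectorBundle.{u, v₂} 𝔽 X}
    (f : Hom V E) : Prop :=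
  ∀ x, Function.Injective (f.onFiber x)

/-- A vector bundle isomorphism over the identity of `X`: a family of `𝔽`-linear isomorphisms
between the fibres that is continuous, with continuous inverse, on total spaces. -/
structure Iso (V : FVectorBundle.{u, v₁} 𝔽 X) (E : FVectorBundle.{u, v₂} 𝔽 X) where
  /-- The linear isomorphisms on fibres. -/
  onFiber : ∀ x, V.Fiber x ≃ₗ[𝔽] E.Fiber x
  continuous_total : Continuous (fun p : V.Total => (⟨p.proj, onFiber p.proj p.snd⟩ : E.Total))
  continuous_total_symm :
    Continuous (fun p : E.Total => (⟨p.proj, (onFiber p.proj).symm p.snd⟩ : V.Total))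

end FVectorBundle

/-- The structure of a relative CW-complex on the pair `(X, A)`: `X` is obtained from the subspace
`A` by successively attaching cells, first of dimension `0`, then of dimension `1`, and so on, and
carries the colimit topology. -/
abbrev RelCWPair {X : Type u} [TopologicalSpace X] (A : Set X) : Type (u + 1) :=
  TopCat.RelativeCWComplex
    (TopCat.ofHom (⟨Subtype.val, continuous_subtype_val⟩ : C(A, X)) : TopCat.of A ⟶ TopCat.of X)

/-- The relative CW-complex has dimension at most `d`: every cell of `X` outside of `A` has dimension
at most `d`. The step `γ.j` at which a cell `γ` is attached is its dimension. -/
def RelCWPair.DimLE {X : Type u} [TopologicalSpace X] {A : Set X} (K : RelCWPair A) (d : ℕ) : Prop :=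
  ∀ γ : HomotopicalAlgebra.RelativeCellComplex.Cells K, γ.j ≤ d

end

/-! Both extensions are built cell by cell. Over a disk all bundles become trivial, so a partial map
on the boundary sphere is a continuous family of matrices. The only obstruction is to extend a
family of `k × m` matrices with independent rows from a compact set to a Euclidean space of
dimension `n`.

No homotopy groups of Stiefel manifolds are needed: general position suffices. Extend the family by
Tietze and approximate it by a `C¹` family `G`. If row `i` of `G x + Y` is a combination of the
other rows, then `Y` is determined by `x`, the `k - 1` coefficients and the other `k - 1` rows of
`Y`. The bad `Y` thus form a finite union of `C¹` images of spaces of real dimension `n + c(k - 1) +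
c(k - 1)m`. This is less than `ckm` exactly when `n + ck < c(m + 1)`, which for `n ≤ d` is what the
ceiling hypothesis gives. A small generic `Y` repairs `G`, and a cutoff function keeps the original
values on the compact set (`exists_extension_linearIndependent`). This gives (1).

For (2), put `Wᵢ = Eᵢ ⊕ V` and deform `φV` through isomorphisms `W₁ → W₂` to one that is the
identity on `V`; that one induces an isomorphism `E₁ ≅ E₂` of the quotients by `V`. The deformation
is constant over `A`. Over an `n`-cell the image of `V` must first be extended over the cylinder,
which is the injection problem in dimension `n + 1`. Then a complement is extended from the base and
side of the cylinder, onto which the cylinder retracts (`exists_isIsoPath_extension_closedBall`).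
The object extended over `X` is a family of paths over `X`, so no cell structure on `X × [0,1]` is
needed.

Triviality over disks comes from subdividing boxes (`hasCompletion_box`). The induction over cells
(`RelCWPair.exists_extension`) handles set-theoretic sections with a `GluingPredicate`, so no
topology on a bundle of homomorphisms is needed. Continuity of a family is tested on local sections
of the source bundle over open sets of `X`; this test descends along quotient maps and hence to the
colimits defining `X`. -/

noncomputable section

open Set Topology Filter

/-! ### Bases and invertible matrices over a division ring. -/

section LinearAlgebra

variable {𝔽 : Type*} [DivisionRing 𝔽]

/-- A family of vectors is a frame if it is a basis. -/
def IsFrame {M κ : Type*} [AddCommGroup M] [Module 𝔽 M] (e : κ → M) : Prop :=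
  LinearIndependent 𝔽 e ∧ ⊤ ≤ Submodule.span 𝔽 (range e)

/-- Determinants are unavailable over a noncommutative `𝔽`. Independent rows span, which gives a
left inverse `N`; then `(M * N - 1) * M = 0`, and independence of the rows makes `N` a right inverse
too. -/
theorem isUnit_iff_linearIndependent_rows {κ : Type*} [Fintype κ] [DecidableEq κ]
    (M : Matrix κ κ 𝔽) : IsUnit M ↔ LinearIndependent 𝔽 (fun i => M i) := by
  have key : ∀ (v : κ → 𝔽), ∑ i, v i • M i = Matrix.vecMul v M := fun v => by
    ext j; simp [Matrix.vecMul, dotProduct]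
  constructor
  · rintro ⟨u, rfl⟩
    rw [Fintype.linearIndependent_iff]
    intro g hg
    rw [key] at hg
    have : Matrix.vecMul g ((u : Matrix κ κ 𝔽) * (↑(u⁻¹) : Matrix κ κ 𝔽)) = 0 := by
      rw [← Matrix.vecMul_vecMul, hg, Matrix.zero_vecMul]
    rw [Units.mul_inv, Matrix.vecMul_one] at this
    exact fun i => congrFun this i
  · intro h
    have hs := h.span_eq_top_of_card_eq_finrank' (by simp)
    have h1 : ∀ i, ∃ c : κ → 𝔽, ∑ j, c j • M j = (1 : Matrix κ κ 𝔽) i := fun i =>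
      (Submodule.mem_span_range_iff_exists_fun 𝔽).1
        (hs ▸ Submodule.mem_top : (1 : Matrix κ κ 𝔽) i ∈ Submodule.span 𝔽 (range fun i => M i))
    choose N hN using h1
    have hNM : Matrix.of N * M = 1 := by
      ext i j
      have := congrFun (hN i) j
      simpa [Matrix.mul_apply] using this
    have hMN : M * Matrix.of N = 1 := by
      have h2 : (M * Matrix.of N - 1) * M = 0 := by
        rw [sub_mul, mul_assoc, hNM]; simp
      have h3 : M * Matrix.of N - 1 = 0 := by
        ext i j
        rw [Fintype.linearIndependent_iff] at h
        refine h (fun j => (M * Matrix.of N - 1) i j) ?_ j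
        have := congrFun h2 i
        rw [key]
        exact this
      exact sub_eq_zero.1 h3
    exact ⟨⟨M, _, hMN, hNM⟩, rfl⟩

theorem LinearIndependent.exists_isFrame_sumElim {M κ : Type*} [Fintype κ] [AddCommGroup M]
    [Module 𝔽 M] [Module.Finite 𝔽 M] {j : κ → M} (hj : LinearIndependent 𝔽 j) {k : ℕ}
    (hk : Module.finrank 𝔽 M = k + Fintype.card κ) :
    ∃ ψ : Fin k → M, IsFrame (𝔽 := 𝔽) (Sum.elim ψ j) := by
  classical
  let b := Module.Basis.sumExtend hj
  have : Finite (κ ⊕ Module.Basis.sumExtendIndex hj) := Module.Finite.finite_basis b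
  have : Finite (Module.Basis.sumExtendIndex hj) :=
    Finite.of_injective _ (Sum.inr_injective (α := κ))
  have := Fintype.ofFinite (Module.Basis.sumExtendIndex hj)
  have hc : Fintype.card (Module.Basis.sumExtendIndex hj) = k := by
    have := Module.finrank_eq_card_basis b
    rw [Fintype.card_sum] at this
    omega
  let e : Fin k ≃ Module.Basis.sumExtendIndex hj := (Fintype.equivFinOfCardEq hc).symm
  let b' := b.reindex ((Equiv.sumComm _ _).trans (Equiv.sumCongr e.symm (Equiv.refl κ)))
  refine ⟨fun i => b (Sum.inr (e i)), ?_⟩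
  have : Sum.elim (fun i => b (Sum.inr (e i))) j = b' := by
    ext i
    rcases i with i | i
    · simp [b']
    · simp [b', b, Module.Basis.sumExtend]
      rfl
  rw [this]
  exact ⟨b'.linearIndependent, b'.span_eq.ge⟩

end LinearAlgebra

/-! ### General position for matrices with independent rows. -/

section Matrices

variable {𝔽 : Type*} [NormedDivisionRing 𝔽] [NormedAlgebra ℝ 𝔽] [FiniteDimensional ℝ 𝔽]

theorem Matrix.continuousAt_ringInverse {κ : Type*} [Fintype κ] [DecidableEq κ]
    {M : Matrix κ κ 𝔽} (hM : IsUnit M) : ContinuousAt (Ring.inverse : Matrix κ κ 𝔽 → _) M := by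
  let _ : NormedRing (Matrix κ κ 𝔽) := Matrix.linftyOpNormedRing
  let _ : NormedAlgebra ℝ (Matrix κ κ 𝔽) := Matrix.linftyOpNormedAlgebra
  have : CompleteSpace (Matrix κ κ 𝔽) := FiniteDimensional.complete ℝ _
  obtain ⟨u, rfl⟩ := hM
  exact NormedRing.inverse_continuousAt u

theorem Matrix.isOpen_isUnit {κ : Type*} [Fintype κ] [DecidableEq κ] :
    IsOpen {M : Matrix κ κ 𝔽 | IsUnit M} := by
  let _ : NormedRing (Matrix κ κ 𝔽) := Matrix.linftyOpNormedRing
  let _ : NormedAlgebra ℝ (Matrix κ κ 𝔽) := Matrix.linftyOpNormedAlgebra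
  have : CompleteSpace (Matrix κ κ 𝔽) := FiniteDimensional.complete ℝ _
  exact Units.isOpen

/-- Complete the rows to a square invertible matrix by fixed extra rows; invertibility is an open
condition. -/
theorem isOpen_linearIndependent_rows {κ : Type*} [Fintype κ] {m : ℕ} :
    IsOpen {M : κ → Fin m → 𝔽 | LinearIndependent 𝔽 M} := by
  classical
  rw [isOpen_iff_mem_nhds]
  intro M hM
  have hM : LinearIndependent 𝔽 M := hM
  obtain ⟨k, hk⟩ : ∃ k, Module.finrank 𝔽 (Fin m → 𝔽) = k + Fintype.card κ :=
    ⟨_, (Nat.sub_add_cancel hM.fintype_card_le_finrank).symm⟩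
  obtain ⟨ψ, hψ⟩ := hM.exists_isFrame_sumElim hk
  have e : (Fin k ⊕ κ) ≃ Fin m := Fintype.equivOfCardEq (by simpa using hk.symm)
  let F : (κ → Fin m → 𝔽) → Matrix (Fin m) (Fin m) 𝔽 := fun M' => (Sum.elim ψ M') ∘ e.symm
  have hF : Continuous F := by
    refine continuous_pi fun i => ?_
    change Continuous fun M' => (Sum.elim ψ M' : Fin k ⊕ κ → Fin m → 𝔽) (e.symm i)
    rcases e.symm i with j | j
    · exact continuous_const
    · exact continuous_apply j
  have hu : F M ∈ {N : Matrix (Fin m) (Fin m) 𝔽 | IsUnit N} :=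
    (isUnit_iff_linearIndependent_rows _).2 ((linearIndependent_equiv e.symm).2 hψ.1)
  filter_upwards [hF.continuousAt.preimage_mem_nhds (Matrix.isOpen_isUnit.mem_nhds hu)] with M' hM'
  have h1 : LinearIndependent 𝔽 ((Sum.elim ψ M' : Fin k ⊕ κ → Fin m → 𝔽) ∘ e.symm) :=
    (isUnit_iff_linearIndependent_rows _).1 hM'
  exact ((linearIndependent_equiv e.symm).1 h1).comp Sum.inr Sum.inr_injective

/-- After an arbitrarily small constant perturbation, a `C¹` family of `k × m` matrices with few
parameters consists of matrices with independent rows. -/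
theorem dense_perturbation_linearIndependent {H : Type*} [NormedAddCommGroup H] [NormedSpace ℝ H]
    [FiniteDimensional ℝ H] {k m : ℕ}
    (hdim : k = 0 ∨ Module.finrank ℝ H + Module.finrank ℝ 𝔽 * k < Module.finrank ℝ 𝔽 * (m + 1))
    {G : H → Fin k → Fin m → 𝔽} (hG : ContDiff ℝ 1 G) :
    Dense {Y : Fin k → Fin m → 𝔽 | ∀ x, LinearIndependent 𝔽 (G x + Y)} := by
  classical
  rcases Nat.eq_zero_or_pos k with rfl | hkpos
  · have : {Y : Fin 0 → Fin m → 𝔽 | ∀ x, LinearIndependent 𝔽 (G x + Y)} = univ :=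
      eq_univ_of_forall fun Y x => linearIndependent_empty_type
    rw [this]
    exact dense_univ
  have : Nonempty (Fin k) := ⟨⟨0, hkpos⟩⟩
  -- Parameters for the bad matrices `Y`: the point, the coefficients expressing row `i` of `G x +
  -- Y` through the others (up to sign), and the other rows of `Y`. `Φ i` recovers `Y` from them.
  let D (i : Fin k) := H × ({l : Fin k // l ≠ i} → 𝔽) × ({l : Fin k // l ≠ i} → Fin m → 𝔽)
  let Φ (i : Fin k) : D i → Fin k → Fin m → 𝔽 := fun p l =>
    if h : l = i then fun a => - G p.1 i a - ∑ l' : {l : Fin k // l ≠ i},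
      p.2.1 l' * (G p.1 l' a + p.2.2 l' a) else p.2.2 ⟨l, h⟩
  have hΦ : ∀ i, ContDiff ℝ 1 (Φ i) := by
    intro i
    have hGc : ∀ l a, ContDiff ℝ 1 fun p : D i => G p.1 l a := fun l a =>
      (contDiff_apply_apply ℝ 𝔽 l a).comp (hG.comp contDiff_fst)
    have h1 : ∀ l, ContDiff ℝ 1 fun p : D i => p.2.1 l := fun l =>
      (contDiff_apply ℝ 𝔽 l).comp (contDiff_fst.comp contDiff_snd)
    have h2 : ∀ l a, ContDiff ℝ 1 fun p : D i => p.2.2 l a := fun l a =>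
      (contDiff_apply_apply ℝ 𝔽 l a).comp (contDiff_snd.comp contDiff_snd)
    rw [contDiff_pi]
    intro l
    rw [contDiff_pi]
    intro a
    by_cases h : l = i
    · simp only [Φ, h, dite_true]
      exact (hGc i a).neg.sub (ContDiff.sum fun l' _ => (h1 l').mul ((hGc _ a).add (h2 l' a)))
    · simp only [Φ, h, dite_false]
      exact h2 _ a
  have hD : ∀ i, Module.finrank ℝ (D i) < Module.finrank ℝ (Fin k → Fin m → 𝔽) := by
    intro i
    have hdim := hdim.resolve_left hkpos.ne'
    obtain ⟨k, rfl⟩ := Nat.exists_eq_succ_of_ne_zero hkpos.ne'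
    have hcard : Fintype.card {l : Fin (k + 1) // l ≠ i} = k := by simp
    simp only [D, Module.finrank_prod, Module.finrank_pi_fintype, Finset.sum_const,
      Finset.card_univ, hcard, Fintype.card_fin, smul_eq_mul]
    nlinarith
  have hdimH : dimH (⋃ i, range (Φ i)) < Module.finrank ℝ (Fin k → Fin m → 𝔽) := by
    rw [dimH_iUnion]
    obtain ⟨i, hi⟩ := exists_eq_ciSup_of_finite (f := fun i => dimH (range (Φ i)))
    rw [← hi]
    exact (hΦ i).dimH_range_le.trans_lt (by exact_mod_cast hD i)
  refine (dense_compl_of_dimH_lt_finrank hdimH).mono fun Y hY x => ?_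
  by_contra hLI
  rw [Fintype.linearIndependent_iff] at hLI
  push Not at hLI
  obtain ⟨g, hg, i, hi⟩ := hLI
  refine hY (mem_iUnion.2 ⟨i, ⟨x, fun l => (g i)⁻¹ * g l, fun l => Y l⟩, ?_⟩)
  ext l a
  by_cases h : l = i
  · subst h
    have h1 := congrFun hg a
    simp only [Finset.sum_apply, Pi.smul_apply, Pi.add_apply, smul_eq_mul, Pi.zero_apply] at h1
    rw [← Finset.add_sum_erase _ _ (Finset.mem_univ l)] at h1
    have h2 : ∑ l' : {l' : Fin k // l' ≠ l}, (g l)⁻¹ * g l' * (G x l' a + Y l' a) =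
        (g l)⁻¹ * ∑ l' ∈ Finset.univ.erase l, g l' * (G x l' a + Y l' a) := by
      rw [Finset.mul_sum]
      simp only [mul_assoc]
      exact (Finset.sum_subtype (Finset.univ.erase l) (by simp)
        (fun l' => (g l)⁻¹ * (g l' * (G x l' a + Y l' a)))).symm
    simp only [Φ, dite_true, h2]
    rw [eq_neg_of_add_eq_zero_right h1]
    rw [mul_neg, ← mul_assoc, inv_mul_cancel₀ hi]
    simp
  · simp [Φ, h]

/-- A continuous family of `k × m` matrices with independent rows over a compact set extends to
the ambient space as long as the dimension of that space is small. -/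
theorem exists_extension_linearIndependent {H : Type*} [NormedAddCommGroup H] [NormedSpace ℝ H]
    [FiniteDimensional ℝ H] {k m : ℕ}
    (hdim : k = 0 ∨ Module.finrank ℝ H + Module.finrank ℝ 𝔽 * k < Module.finrank ℝ 𝔽 * (m + 1))
    {A : Set H} (hA : IsCompact A) {M : H → Fin k → Fin m → 𝔽} (hM : ContinuousOn M A)
    (hLI : ∀ x ∈ A, LinearIndependent 𝔽 (M x)) :
    ∃ M' : H → Fin k → Fin m → 𝔽, Continuous M' ∧ EqOn M' M A ∧
      ∀ x, LinearIndependent 𝔽 (M' x) := by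
  have : TietzeExtension 𝔽 := TietzeExtension.of_tvs ℝ
  obtain ⟨f, hf⟩ := ContinuousMap.exists_restrict_eq hA.isClosed
    (⟨A.domRestrict M, hM.domRestrict⟩ : C(A, Fin k → Fin m → 𝔽))
  have hfM : EqOn f M A := fun x hx => DFunLike.congr_fun hf ⟨x, hx⟩
  obtain ⟨δ, hδ, hthick⟩ := (hA.image f.continuous).exists_thickening_subset_open
    (isOpen_linearIndependent_rows (𝔽 := 𝔽) (κ := Fin k) (m := m)) (by
      rintro _ ⟨x, hx, rfl⟩
      change LinearIndependent 𝔽 (f x)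
      rw [hfM hx]
      exact hLI x hx)
  -- Smoothing and perturbation each cost `δ / 4`. Where `f` is within `δ / 2` of `f '' A`, every
  -- interpolation between `f` and `G + Y` stays in the `δ`-thickening, hence independent; elsewhere
  -- the cutoff is `1` and the value is exactly `G x + Y`.
  obtain ⟨G, hG, hGf, -⟩ := f.continuous.exists_contDiff_approx 1 (ε := fun _ => δ / 4)
    continuous_const (fun _ => by positivity)
  obtain ⟨Y, hYmem, hY⟩ := (dense_perturbation_linearIndependent hdim hG).exists_dist_lt 0
    (show 0 < δ / 4 by positivity)
  let U : Set H := f ⁻¹' Metric.thickening (δ / 2) (f '' A)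
  have hU : IsOpen U := Metric.isOpen_thickening.preimage f.continuous
  have hAU : A ⊆ U := fun x hx => Metric.self_subset_thickening (by positivity) _ ⟨x, hx, rfl⟩
  obtain ⟨l, hl0, hl1, hl⟩ := exists_continuous_zero_one_of_isClosed hA.isClosed
    hU.isClosed_compl (disjoint_compl_right_iff_subset.2 hAU)
  refine ⟨fun x => f x + l x • (G x + Y - f x), ?_, fun x hx => ?_, fun x => ?_⟩
  · have := hG.continuous
    fun_prop
  · simp [hl0 hx, hfM hx]
  · by_cases hx : x ∈ U
    · refine hthick ?_
      obtain ⟨z, hz, hxz⟩ := Metric.mem_thickening_iff.1 hx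
      refine Metric.mem_thickening_iff.2 ⟨z, hz, ?_⟩
      have h1 : ‖l x • (G x + Y - f x)‖ ≤ δ / 2 := by
        have h2 := hGf x
        rw [dist_eq_norm] at h2
        rw [dist_zero_left] at hY
        have h3 : ‖G x + Y - f x‖ ≤ δ / 2 := by
          have : G x + Y - f x = (G x - f x) + Y := by abel
          rw [this]
          refine (norm_add_le _ _).trans ?_
          linarith
        rw [norm_smul, Real.norm_of_nonneg (hl x).1]
        calc l x * ‖G x + Y - f x‖ ≤ 1 * ‖G x + Y - f x‖ := by
              gcongr
              exact (hl x).2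
          _ ≤ δ / 2 := by rwa [one_mul]
      calc dist (f x + l x • (G x + Y - f x)) z
          ≤ dist (f x + l x • (G x + Y - f x)) (f x) + dist (f x) z := dist_triangle _ _ _
        _ < δ := by
          rw [dist_self_add_left]
          linarith
    · beta_reduce
      rw [hl1 hx]
      have : f x + (1 : H → ℝ) x • (G x + Y - f x) = G x + Y := by simp
      rw [this]
      exact hYmem x

end Matrices

/-! ### Local charts, and continuity of sections and their coefficients. -/

namespace FVectorBundle

section Charts

variable {𝔽 : Type w} [NormedDivisionRing 𝔽] {X : Type u} [TopologicalSpace X]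

/-- A local trivialization of a vector bundle, extended arbitrarily to all fibres. -/
structure LocalChart (E : FVectorBundle.{u, v} 𝔽 X) where
  /-- The open set over which the bundle is trivialized. -/
  U : Set X
  /-- The rank. -/
  n : ℕ
  /-- The coordinates on the fibres. -/
  φ : ∀ x, E.Fiber x →ₗ[𝔽] (Fin n → 𝔽)
  /-- The inverse of the coordinates. -/
  ψ : ∀ x, (Fin n → 𝔽) →ₗ[𝔽] E.Fiber x
  isOpen : IsOpen U
  ψ_φ : ∀ x ∈ U, ∀ v, ψ x (φ x v) = v
  φ_ψ : ∀ x ∈ U, ∀ v, φ x (ψ x v) = v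
  continuousOn_φ : ContinuousOn (fun p : E.Total => φ p.proj p.snd) {p | p.proj ∈ U}
  continuousOn_ψ : ContinuousOn (fun q : X × (Fin n → 𝔽) => (⟨q.1, ψ q.1 q.2⟩ : E.Total))
    {q | q.1 ∈ U}

theorem exists_localChart (E : FVectorBundle.{u, v} 𝔽 X) (x₀ : X) :
    ∃ C : LocalChart E, x₀ ∈ C.U := by
  classical
  obtain ⟨U, n, φ, hU, hx, hφ⟩ := E.locally_trivial x₀
  let H := hφ.homeomorph _
  have hHinv : ∀ q : U × (Fin n → 𝔽), H.symm q = ⟨⟨q.1.1, (φ q.1).symm q.2⟩, q.1.2⟩ := by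
    intro q
    rw [Homeomorph.symm_apply_eq]
    change q = (⟨q.1.1, q.1.2⟩, φ q.1 ((φ q.1).symm q.2))
    simp
  refine ⟨{ U := U, n := n, isOpen := hU
            φ := fun x => if h : x ∈ U then (φ ⟨x, h⟩).toLinearMap else 0
            ψ := fun x => if h : x ∈ U then (φ ⟨x, h⟩).symm.toLinearMap else 0
            ψ_φ := fun x hx v => by simp [hx]
            φ_ψ := fun x hx v => by simp [hx]
            continuousOn_φ := ?_
            continuousOn_ψ := ?_ }, hx⟩
  · rw [continuousOn_iff_continuous_domRestrict]
    refine (continuous_snd.comp hφ.continuous).congr fun p => ?_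
    have : p.1.proj ∈ U := p.2
    simp [this]
  · rw [continuousOn_iff_continuous_domRestrict]
    have h1 : Continuous fun q : {q : X × (Fin n → 𝔽) // q.1 ∈ U} =>
      ((⟨q.1.1, q.2⟩, q.1.2) : U × (Fin n → 𝔽)) := by fun_prop
    refine (continuous_subtype_val.comp (H.symm.continuous.comp h1)).congr fun q => ?_
    have : q.1.1 ∈ U := q.2
    simp [hHinv, this]

variable {E : FVectorBundle.{u, v} 𝔽 X}

theorem LocalChart.bijective (C : LocalChart E) {x : X} (hx : x ∈ C.U) :
    Function.Bijective (C.φ x) :=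
  Function.bijective_iff_has_inverse.2 ⟨C.ψ x, C.ψ_φ x hx, C.φ_ψ x hx⟩

theorem LocalChart.finrank_eq (C : LocalChart E) {x : X} (hx : x ∈ C.U) :
    Module.finrank 𝔽 (E.Fiber x) = C.n := by
  rw [(LinearEquiv.ofBijective _ (C.bijective hx)).finrank_eq, Module.finrank_fin_fun]

instance finite_fiber (E : FVectorBundle.{u, v} 𝔽 X) (x : X) : Module.Finite 𝔽 (E.Fiber x) := by
  obtain ⟨C, hC⟩ := E.exists_localChart x
  exact Module.Finite.equiv (LinearEquiv.ofBijective _ (C.bijective hC)).symm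

theorem isLocallyConstant_finrank (E : FVectorBundle.{u, v} 𝔽 X) :
    IsLocallyConstant fun x => Module.finrank 𝔽 (E.Fiber x) := by
  rw [IsLocallyConstant.iff_exists_open]
  intro x
  obtain ⟨C, hC⟩ := E.exists_localChart x
  exact ⟨C.U, C.isOpen, hC, fun y hy => (C.finrank_eq hy).trans (C.finrank_eq hC).symm⟩

variable {T : Type*} [TopologicalSpace T] {f : T → X} {S : Set T} {t : T}

theorem LocalChart.continuousWithinAt_iff (C : LocalChart E) {σ : ∀ t, E.Fiber (f t)}
    (hf : ContinuousWithinAt f S t) (ht : f t ∈ C.U) :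
    ContinuousWithinAt (fun t => (⟨f t, σ t⟩ : E.Total)) S t ↔
      ContinuousWithinAt (fun t => C.φ (f t) (σ t)) S t := by
  constructor
  · intro h
    have h1 : ContinuousAt (fun p : E.Total => C.φ p.proj p.snd) ⟨f t, σ t⟩ :=
      C.continuousOn_φ.continuousAt ((C.isOpen.preimage E.continuous_proj).mem_nhds ht)
    exact ContinuousAt.comp_continuousWithinAt (f := fun t => (⟨f t, σ t⟩ : E.Total)) h1 h
  · intro h
    have h1 : ContinuousAt (fun q : X × (Fin C.n → 𝔽) => (⟨q.1, C.ψ q.1 q.2⟩ : E.Total))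
        (f t, C.φ (f t) (σ t)) :=
      C.continuousOn_ψ.continuousAt ((C.isOpen.preimage continuous_fst).mem_nhds ht)
    have h2 := ContinuousAt.comp_continuousWithinAt
      (f := fun t => (f t, C.φ (f t) (σ t))) h1 (hf.prodMk h)
    refine h2.congr_of_eventuallyEq ?_ (by simp [C.ψ_φ _ ht])
    filter_upwards [hf (C.isOpen.mem_nhds ht)] with t' ht'
    simp [C.ψ_φ _ ht']

theorem continuousWithinAt_sum {κ : Type*} [Fintype κ] (hf : ContinuousWithinAt f S t)
    {σ : ∀ t, κ → E.Fiber (f t)} {a : T → κ → 𝔽}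
    (hσ : ∀ i, ContinuousWithinAt (fun t => (⟨f t, σ t i⟩ : E.Total)) S t)
    (ha : ContinuousWithinAt a S t) :
    ContinuousWithinAt (fun t => (⟨f t, ∑ i, a t i • σ t i⟩ : E.Total)) S t := by
  obtain ⟨C, hC⟩ := E.exists_localChart (f t)
  rw [C.continuousWithinAt_iff hf hC]
  simp only [map_sum, map_smul]
  have h1 : ∀ i, ContinuousWithinAt (fun t => C.φ (f t) (σ t i)) S t := fun i =>
    (C.continuousWithinAt_iff hf hC).1 (hσ i)
  have h2 : ∀ i, ContinuousWithinAt (fun t => a t i) S t := continuousWithinAt_pi.1 ha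
  rw [continuousWithinAt_pi]
  intro b
  simp only [Finset.sum_apply, Pi.smul_apply, smul_eq_mul]
  have h3 : ContinuousWithinAt (fun t => fun i => a t i * C.φ (f t) (σ t i) b) S t :=
    continuousWithinAt_pi.2 fun i => (h2 i).mul (continuousWithinAt_pi.1 (h1 i) b)
  exact (continuous_finsetSum Finset.univ
    fun i _ => continuous_apply i).continuousAt.comp_continuousWithinAt h3

theorem continuousWithinAt_zero (hf : ContinuousWithinAt f S t) :
    ContinuousWithinAt (fun t => (⟨f t, 0⟩ : E.Total)) S t := by
  obtain ⟨C, hC⟩ := E.exists_localChart (f t)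
  rw [C.continuousWithinAt_iff hf hC]
  simp only [map_zero]
  exact continuousWithinAt_const

section Frames

/-- The coordinate matrix of a family of vectors in a local chart. -/
def LocalChart.toMatrix (C : LocalChart E) {κ : Type*} (g : κ → Fin C.n) {x : X}
    (e : κ → E.Fiber x) : Matrix κ κ 𝔽 := fun i k => C.φ x (e i) (g k)

theorem exists_matrix_of_isFrame {κ : Type*} [Fintype κ] [DecidableEq κ]
    (hf : ContinuousWithinAt f S t) {e : ∀ t, κ → E.Fiber (f t)}
    (he : ∀ i, ContinuousWithinAt (fun t => (⟨f t, e t i⟩ : E.Total)) S t)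
    (hcard : Module.finrank 𝔽 (E.Fiber (f t)) = Fintype.card κ) :
    ∃ (C : LocalChart E) (g : κ ≃ Fin C.n), f t ∈ C.U ∧
      ContinuousWithinAt (fun t => C.toMatrix g (e t)) S t ∧
      ∀ t, f t ∈ C.U → (IsUnit (C.toMatrix g (e t)) ↔ LinearIndependent 𝔽 (e t)) := by
  obtain ⟨C, hC⟩ := E.exists_localChart (f t)
  let g : κ ≃ Fin C.n := Fintype.equivOfCardEq (by
    rw [Fintype.card_fin, ← hcard, C.finrank_eq hC])
  refine ⟨C, g, hC, ?_, fun t ht => ?_⟩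
  · refine continuousWithinAt_pi.2 fun i => continuousWithinAt_pi.2 fun k => ?_
    exact continuousWithinAt_pi.1 ((C.continuousWithinAt_iff hf hC).1 (he i)) (g k)
  · rw [isUnit_iff_linearIndependent_rows]
    let L : E.Fiber (f t) →ₗ[𝔽] (κ → 𝔽) := (LinearEquiv.funCongrLeft 𝔽 𝔽 g).toLinearMap ∘ₗ C.φ (f t)
    have hL : Function.Injective L := by
      rw [LinearMap.coe_comp]
      exact (LinearEquiv.funCongrLeft 𝔽 𝔽 g).injective.comp (C.bijective ht).1
    exact L.linearIndependent_iff_of_injOn hL.injOn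

variable [NormedAlgebra ℝ 𝔽] [FiniteDimensional ℝ 𝔽]

/-- In a chart the frame is an invertible matrix `M` and the coefficients are the coordinates of `σ`
times `M⁻¹`; inversion is continuous at invertible matrices. The frame condition is needed only at
`t`, as it persists nearby. -/
theorem continuousWithinAt_coeff {κ : Type*} [Fintype κ] (hf : ContinuousWithinAt f S t)
    {e : ∀ t, κ → E.Fiber (f t)}
    (he : ∀ i, ContinuousWithinAt (fun t => (⟨f t, e t i⟩ : E.Total)) S t)
    (hframe : IsFrame (𝔽 := 𝔽) (e t)) {a : T → κ → 𝔽} {σ : ∀ t, E.Fiber (f t)}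
    (hσ : ContinuousWithinAt (fun t => (⟨f t, σ t⟩ : E.Total)) S t) (ht : t ∈ S)
    (ha : ∀ t ∈ S, ∑ i, a t i • e t i = σ t) :
    ContinuousWithinAt a S t := by
  classical
  obtain ⟨C, g, hC, hM, hunit⟩ := exists_matrix_of_isFrame hf he
    (Module.finrank_eq_card_basis (Module.Basis.mk hframe.1 hframe.2))
  set M : T → Matrix κ κ 𝔽 := fun t => C.toMatrix g (e t) with hMdef
  have hu : IsUnit (M t) := (hunit t hC).2 hframe.1
  have hs : ContinuousWithinAt (fun t k => C.φ (f t) (σ t) (g k)) S t :=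
    continuousWithinAt_pi.2 fun k =>
      continuousWithinAt_pi.1 ((C.continuousWithinAt_iff hf hC).1 hσ) (g k)
  have hinv : ContinuousWithinAt (fun t => Ring.inverse (M t)) S t :=
    (Matrix.continuousAt_ringInverse hu).comp_continuousWithinAt hM
  have hprod : ContinuousWithinAt
      (fun t => Matrix.vecMul (fun k => C.φ (f t) (σ t) (g k)) (Ring.inverse (M t))) S t := by
    have hc : Continuous fun p : (κ → 𝔽) × Matrix κ κ 𝔽 => Matrix.vecMul p.1 p.2 :=
      continuous_fst.matrix_vecMul continuous_snd
    exact hc.continuousAt.comp_continuousWithinAt (hs.prodMk hinv)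
  have key : ∀ t ∈ S, IsUnit (M t) →
      a t = Matrix.vecMul (fun k => C.φ (f t) (σ t) (g k)) (Ring.inverse (M t)) := by
    intro t ht hu
    have h1 : (fun k => C.φ (f t) (σ t) (g k)) = Matrix.vecMul (a t) (M t) := by
      ext k
      rw [← ha t ht]
      simp [Matrix.vecMul, dotProduct, hMdef, LocalChart.toMatrix]
    rw [h1, Matrix.vecMul_vecMul, Ring.mul_inverse_cancel _ hu, Matrix.vecMul_one]
  refine hprod.congr_of_eventuallyEq ?_ (key t ht hu)
  filter_upwards [hM (Matrix.isOpen_isUnit.mem_nhds hu), self_mem_nhdsWithin] with t' h1 h2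
  exact key t' h2 h1

theorem eventually_isFrame {κ : Type*} [Fintype κ] (hf : ContinuousWithinAt f S t)
    {e : ∀ t, κ → E.Fiber (f t)}
    (he : ∀ i, ContinuousWithinAt (fun t => (⟨f t, e t i⟩ : E.Total)) S t)
    (hframe : IsFrame (𝔽 := 𝔽) (e t)) : ∀ᶠ t' in 𝓝[S] t, IsFrame (𝔽 := 𝔽) (e t') := by
  classical
  have hcard := Module.finrank_eq_card_basis (Module.Basis.mk hframe.1 hframe.2)
  obtain ⟨C, g, hC, hM, hunit⟩ := exists_matrix_of_isFrame hf he hcard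
  filter_upwards [hM (Matrix.isOpen_isUnit.mem_nhds ((hunit t hC).2 hframe.1)),
    hf (C.isOpen.mem_nhds hC)] with t' h1 h2
  have h3 := (hunit t' h2).1 h1
  refine ⟨h3, (h3.span_eq_top_of_card_eq_finrank' ?_).ge⟩
  rw [← hcard, C.finrank_eq h2, C.finrank_eq hC]

end Frames

end Charts

end FVectorBundle

/-! ### Coefficient matrices with respect to a frame. -/

section Algebra

variable {𝔽 : Type*} [DivisionRing 𝔽] {M κ : Type*} [AddCommGroup M] [Module 𝔽 M] [Fintype κ]

theorem IsFrame.exists_sum_eq {e : κ → M} (he : IsFrame (𝔽 := 𝔽) e) (x : M) :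
    ∃ a : κ → 𝔽, ∑ s, a s • e s = x :=
  (Submodule.mem_span_range_iff_exists_fun 𝔽).1 (he.2 trivial)

theorem IsFrame.finrank_eq {e : κ → M} (he : IsFrame (𝔽 := 𝔽) e) :
    Module.finrank 𝔽 M = Fintype.card κ :=
  Module.finrank_eq_card_basis (Module.Basis.mk he.1 he.2)

theorem IsFrame.linearIndependent_sum_smul_iff {ι : Type*} {e : κ → M}
    (he : IsFrame (𝔽 := 𝔽) e) (B : ι → κ → 𝔽) :
    LinearIndependent 𝔽 (fun i => ∑ s, B i s • e s) ↔ LinearIndependent 𝔽 B := by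
  let L : (κ → 𝔽) →ₗ[𝔽] M := (Module.Basis.mk he.1 he.2).equivFun.symm.toLinearMap
  have hL : Function.Injective L := (Module.Basis.mk he.1 he.2).equivFun.symm.injective
  have : (fun i => ∑ s, B i s • e s) = L ∘ B := by
    ext i
    simp [L, Module.Basis.equivFun_symm_apply]
  rw [this]
  exact L.linearIndependent_iff_of_injOn hL.injOn

theorem IsFrame.sum_smul_iff {e : κ → M} (he : IsFrame (𝔽 := 𝔽) e) (B : κ → κ → 𝔽) :
    IsFrame (𝔽 := 𝔽) (fun i => ∑ s, B i s • e s) ↔ LinearIndependent 𝔽 B := by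
  have := Module.Finite.of_basis (Module.Basis.mk he.1 he.2)
  rw [← he.linearIndependent_sum_smul_iff B]
  exact ⟨fun h => h.1, fun h => ⟨h, (h.span_eq_top_of_card_eq_finrank' he.finrank_eq.symm).ge⟩⟩

/-- Replacing part of a frame: the coefficient matrix determines whether the result is a frame. -/
theorem IsFrame.sumElim_iff [DecidableEq κ] {k : ℕ} {ψ : Fin k → M} {j : κ → M}
    (he : IsFrame (𝔽 := 𝔽) (Sum.elim ψ j)) (A : Fin k → Fin k ⊕ κ → 𝔽) :
    IsFrame (𝔽 := 𝔽) (Sum.elim (fun i => ∑ s, A i s • Sum.elim ψ j s) j) ↔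
      LinearIndependent 𝔽 (Sum.elim A fun i => Pi.single (Sum.inr i) 1) := by
  rw [← he.sum_smul_iff]
  have : (Sum.elim (fun i => ∑ s, A i s • Sum.elim ψ j s) j) = fun i => ∑ s,
      (Sum.elim A (fun i => Pi.single (Sum.inr i) 1) : Fin k ⊕ κ → Fin k ⊕ κ → 𝔽) i s •
        Sum.elim ψ j s := by
    ext i
    rcases i with i | i
    · simp only [Sum.elim_inl]
    · simp [Pi.single_apply, -Fintype.sum_sum_type]
  rw [this]

end Algebra

/-! ### Completing independent sections to frames over boxes. -/

/-- An induction principle for boxes: a property that holds for small boxes and passes from the two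
parts of a subdivided box to the whole box holds for all boxes. -/
theorem box_induction {N : ℕ} {p : (Fin N → ℝ) → (Fin N → ℝ) → Prop} {ε : ℝ} (hε : 0 < ε)
    (small : ∀ a b, (∀ i, b i - a i ≤ ε) → p a b)
    (glue : ∀ a b i c, a i ≤ c → c ≤ b i → p a (Function.update b i c) →
      p (Function.update a i c) b → p a b) (a b : Fin N → ℝ) : p a b := by
  -- Only the first `n` sides may be long. Passing to `n + 1` cuts slices of width `ε` off the new
  -- long side, by induction on the number of slices.
  have main : ∀ n ≤ N, ∀ a b : Fin N → ℝ, (∀ l : Fin N, n ≤ l → b l - a l ≤ ε) → p a b := by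
    intro n
    induction n with
    | zero => exact fun _ a b h => small a b fun i => h i (Nat.zero_le _)
    | succ n ih =>
      intro hn
      have ih := ih (by omega)
      let i : Fin N := ⟨n, hn⟩
      have hl : ∀ l : Fin N, n ≤ l → l ≠ i → n + 1 ≤ l := fun l h h' => by
        have : (l : ℕ) ≠ n := fun h'' => h' (Fin.ext h'')
        omega
      have step : ∀ m : ℕ, ∀ a b : Fin N → ℝ, (∀ l : Fin N, n + 1 ≤ l → b l - a l ≤ ε) →
          b i - a i ≤ (m + 1) * ε → p a b := by
        intro m
        induction m with
        | zero =>
          intro a b h h'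
          refine ih a b fun l hnl => ?_
          by_cases hli : l = i
          · subst hli
            simpa using h'
          · exact h l (hl l hnl hli)
        | succ m ihm =>
          intro a b h h'
          by_cases hs : b i - a i ≤ ε
          · refine ih a b fun l hnl => ?_
            by_cases hli : l = i
            · subst hli
              exact hs
            · exact h l (hl l hnl hli)
          · refine glue a b i (b i - ε) (by linarith) (by linarith) ?_ ?_
            · refine ihm _ _ (fun l hnl => ?_) ?_
              · have : l ≠ i := fun h => by subst h; simp [i] at hnl
                simpa [Function.update_of_ne this] using h l hnl
              · push_cast at h'
                simp only [Function.update_self]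
                linarith
            · refine ih _ _ fun l hnl => ?_
              by_cases hli : l = i
              · subst hli
                simp
              · simpa [Function.update_of_ne hli] using h l (hl l hnl hli)
      intro a b h
      obtain ⟨m, hm⟩ := exists_nat_gt ((b i - a i) / ε)
      refine step m a b h ?_
      rw [div_lt_iff₀ hε] at hm
      nlinarith
  exact main N le_rfl a b fun l hl => absurd l.2 (by omega)

namespace FVectorBundle

variable {𝔽 : Type w} [NormedDivisionRing 𝔽] {X : Type u} [TopologicalSpace X]
  {W : FVectorBundle.{u, v} 𝔽 X}
  {T : Type*} [TopologicalSpace T] {f : T → X} {κ : Type*} {k : ℕ}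

/-- The family `j` of sections of `W` along `f` can be completed to a frame over `S`. -/
def HasCompletion (W : FVectorBundle.{u, v} 𝔽 X) (f : T → X) (j : ∀ t, κ → W.Fiber (f t)) (k : ℕ)
    (S : Set T) : Prop :=
  ∃ ψ : ∀ t, Fin k → W.Fiber (f t),
    (∀ i, ContinuousOn (fun t => (⟨f t, ψ t i⟩ : W.Total)) S) ∧
    ∀ t ∈ S, IsFrame (𝔽 := 𝔽) (Sum.elim (ψ t) (j t))

variable {j : ∀ t, κ → W.Fiber (f t)}

theorem HasCompletion.mono {S S' : Set T} (h : HasCompletion W f j k S) (hS : S' ⊆ S) :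
    HasCompletion W f j k S' :=
  let ⟨ψ, h1, h2⟩ := h
  ⟨ψ, fun i => (h1 i).mono hS, fun t ht => h2 t (hS ht)⟩

variable [NormedAlgebra ℝ 𝔽] [FiniteDimensional ℝ 𝔽]

theorem exists_continuousOn_coeff {ι κ : Type*} [Fintype κ] {S : Set T} (hf : Continuous f)
    {e : ∀ t, κ → W.Fiber (f t)}
    (he : ∀ s, ContinuousOn (fun t => (⟨f t, e t s⟩ : W.Total)) S)
    (hframe : ∀ t ∈ S, IsFrame (𝔽 := 𝔽) (e t)) {σ : ∀ t, ι → W.Fiber (f t)}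
    (hσ : ∀ i, ContinuousOn (fun t => (⟨f t, σ t i⟩ : W.Total)) S) :
    ∃ A : T → ι → κ → 𝔽, ContinuousOn A S ∧ ∀ t ∈ S, ∀ i, ∑ s, A t i s • e t s = σ t i := by
  have hA : ∀ t, ∃ A : ι → κ → 𝔽, t ∈ S → ∀ i, ∑ s, A i s • e t s = σ t i := by
    intro t
    by_cases ht : t ∈ S
    · choose A hA using fun i => (hframe t ht).exists_sum_eq (σ t i)
      exact ⟨A, fun _ => hA⟩
    · exact ⟨0, fun h => absurd h ht⟩
  choose A hA using hA
  refine ⟨A, continuousOn_pi.2 fun i t ht => ?_, hA⟩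
  exact continuousWithinAt_coeff (E := W) hf.continuousWithinAt (fun s => he s t ht)
    (hframe t ht) (hσ i t ht) ht (fun t ht => hA t ht i)

variable [Fintype κ]

/-- Complete at the single point `t`, spread the new vectors as constants in a chart, and use that
being a frame is an open condition. -/
theorem exists_open_hasCompletion {S : Set T} (hf : Continuous f)
    (hj : ∀ i, ContinuousOn (fun t => (⟨f t, j t i⟩ : W.Total)) S)
    {t : T} (ht : t ∈ S) (hLI : LinearIndependent 𝔽 (j t))
    (hrank : Module.finrank 𝔽 (W.Fiber (f t)) = k + Fintype.card κ) :
    ∃ O : Set T, IsOpen O ∧ t ∈ O ∧ HasCompletion W f j k (O ∩ S) := by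
  obtain ⟨ψ₀, hψ₀⟩ := hLI.exists_isFrame_sumElim hrank
  obtain ⟨C, hC⟩ := W.exists_localChart (f t)
  let ψ : ∀ t, Fin k → W.Fiber (f t) := fun t' i => C.ψ (f t') (C.φ (f t) (ψ₀ i))
  have hψt : ψ t = ψ₀ := funext fun i => C.ψ_φ _ hC _
  have hψ : ∀ i, ∀ t' ∈ f ⁻¹' C.U, ContinuousAt (fun t => (⟨f t, ψ t i⟩ : W.Total)) t' := by
    intro i t' ht'
    rw [← continuousWithinAt_univ, C.continuousWithinAt_iff hf.continuousWithinAt ht']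
    have hconst : ContinuousWithinAt (fun _ : T => C.φ (f t) (ψ₀ i)) univ t' :=
      continuousWithinAt_const
    refine hconst.congr_of_eventuallyEq ?_ (C.φ_ψ _ ht' _)
    filter_upwards [hf.continuousWithinAt (C.isOpen.mem_nhds ht')] with t'' h
    exact C.φ_ψ _ h _
  have hev := eventually_isFrame (E := W) (S := S) (e := fun t => Sum.elim (ψ t) (j t))
    hf.continuousWithinAt
    (by
      rintro (i | i)
      · exact (hψ i t hC).continuousWithinAt
      · exact hj i t ht) (by rw [hψt]; exact hψ₀)
  obtain ⟨O, hO, htO, hsub⟩ := mem_nhdsWithin.1 hev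
  refine ⟨O ∩ f ⁻¹' C.U, hO.inter (C.isOpen.preimage hf), ⟨htO, hC⟩, ψ, fun i => ?_, ?_⟩
  · exact fun t' ht' => (hψ i t' ht'.1.2).continuousWithinAt
  · exact fun t' ht' => hsub ⟨ht'.1.1, ht'.2⟩

/-- A completion over a retract of `S` extends to `S`, provided that some completion over `S`
exists. -/
theorem HasCompletion.exists_extension {S S₀ : Set T} (hS₀ : S₀ ⊆ S) (hf : Continuous f)
    (hj : ∀ i, ContinuousOn (fun t => (⟨f t, j t i⟩ : W.Total)) S)
    {pr : T → T} (hpr : ContinuousOn pr S) (hmem : ∀ t ∈ S, pr t ∈ S₀) (hfix : ∀ t ∈ S₀, pr t = t)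
    (h : HasCompletion W f j k S) {ψ₀ : ∀ t, Fin k → W.Fiber (f t)}
    (hc₀ : ∀ i, ContinuousOn (fun t => (⟨f t, ψ₀ t i⟩ : W.Total)) S₀)
    (hf₀ : ∀ t ∈ S₀, IsFrame (𝔽 := 𝔽) (Sum.elim (ψ₀ t) (j t))) :
    ∃ ψ : ∀ t, Fin k → W.Fiber (f t),
      (∀ i, ContinuousOn (fun t => (⟨f t, ψ t i⟩ : W.Total)) S) ∧
      (∀ t ∈ S, IsFrame (𝔽 := 𝔽) (Sum.elim (ψ t) (j t))) ∧ ∀ t ∈ S₀, ψ t = ψ₀ t := by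
  classical
  obtain ⟨ψ₁, hc₁, hf₁⟩ := h
  have hcont : ∀ s, ContinuousOn (fun t => (⟨f t, Sum.elim (ψ₁ t) (j t) s⟩ : W.Total)) S := by
    rintro (s | s)
    · exact hc₁ s
    · exact hj s
  obtain ⟨A, hAc, hA⟩ := exists_continuousOn_coeff (W := W) hf (fun s => (hcont s).mono hS₀)
    (fun t ht => hf₁ t (hS₀ ht)) hc₀
  -- Express `ψ₀` over `S₀` in the frame `(ψ₁, j)` and transport the coefficients to `S` along the
  -- retraction. Whether the result is a frame depends only on these coefficients.
  refine ⟨fun t i => ∑ s, A (pr t) i s • Sum.elim (ψ₁ t) (j t) s, fun i t ht => ?_,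
    fun t ht => ?_, fun t ht => ?_⟩
  · exact continuousWithinAt_sum (E := W) hf.continuousWithinAt (fun s => hcont s t ht)
      ((continuousOn_pi.1 hAc i).comp hpr hmem t ht)
  · rw [(hf₁ t ht).sumElim_iff, ← (hf₁ (pr t) (hS₀ (hmem t ht))).sumElim_iff]
    simp only [hA _ (hmem t ht)]
    exact hf₀ _ (hmem t ht)
  · ext i
    simp only [hfix t ht, hA t ht]

/-- The two completions may disagree on the overlap. Since `S₂` retracts onto it, the one over `S₂`
can be replaced by an extension of the restriction of the one over `S₁`. -/
theorem HasCompletion.union {S₁ S₂ : Set T} (hS₁ : IsClosed S₁) (hS₂ : IsClosed S₂)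
    (hf : Continuous f) (hj : ∀ i, ContinuousOn (fun t => (⟨f t, j t i⟩ : W.Total)) (S₁ ∪ S₂))
    {pr : T → T} (hpr : Continuous pr) (hmem : ∀ t ∈ S₂, pr t ∈ S₁ ∩ S₂)
    (hfix : ∀ t ∈ S₁ ∩ S₂, pr t = t)
    (h₁ : HasCompletion W f j k S₁) (h₂ : HasCompletion W f j k S₂) :
    HasCompletion W f j k (S₁ ∪ S₂) := by
  classical
  obtain ⟨ψ₁, hc₁, hf₁⟩ := h₁
  obtain ⟨ψ', hψ'c, hψ'f, hψψ'⟩ := h₂.exists_extension inter_subset_right hf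
    (fun i => (hj i).mono subset_union_right) hpr.continuousOn hmem hfix
    (fun i => (hc₁ i).mono inter_subset_left) (fun t ht => hf₁ t ht.1)
  refine ⟨fun t => if t ∈ S₁ then ψ₁ t else ψ' t, fun i => ?_, fun t ht => ?_⟩
  · refine ContinuousOn.union_of_isClosed ?_ ?_ hS₁ hS₂
    · refine (hc₁ i).congr fun t ht => ?_
      simp [ht]
    · refine (hψ'c i).congr fun t ht => ?_
      by_cases h : t ∈ S₁
      · simp [h, hψψ' t ⟨h, ht⟩]
      · simp [h]
  · by_cases h : t ∈ S₁
    · simpa [h] using hf₁ t h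
    · simpa [h] using hψ'f t (ht.resolve_left h)

/-- Over a box, every independent family of sections can be completed to a frame. -/
theorem hasCompletion_box {N : ℕ} (L : T ≃ₜ (Fin N → ℝ)) (hf : Continuous f) (a b : Fin N → ℝ)
    (hj : ∀ i, ContinuousOn (fun t => (⟨f t, j t i⟩ : W.Total)) (L ⁻¹' Icc a b))
    (hLI : ∀ t ∈ L ⁻¹' Icc a b, LinearIndependent 𝔽 (j t))
    (hrank : ∀ t ∈ L ⁻¹' Icc a b, Module.finrank 𝔽 (W.Fiber (f t)) = k + Fintype.card κ) :
    HasCompletion W f j k (L ⁻¹' Icc a b) := by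
  choose O hO htO hsol using fun t : L ⁻¹' Icc a b =>
    exists_open_hasCompletion hf hj t.2 (hLI t t.2) (hrank t t.2)
  obtain ⟨δ, hδ, hleb⟩ := lebesgue_number_lemma_of_metric (isCompact_Icc (a := a) (b := b))
    (c := fun t => L.symm ⁻¹' (O t)) (fun t => (hO t).preimage L.symm.continuous) (fun x hx => by
      have hx' : L.symm x ∈ L ⁻¹' Icc a b := by simpa using hx
      exact mem_iUnion.2 ⟨⟨L.symm x, hx'⟩, htO ⟨L.symm x, hx'⟩⟩)
  refine box_induction (p := fun a' b' => Icc a' b' ⊆ Icc a b →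
    HasCompletion W f j k (L ⁻¹' Icc a' b')) (half_pos hδ) ?_ ?_ a b subset_rfl
  · intro a' b' hside hsub
    by_cases hab : a' ≤ b'
    · obtain ⟨t, ht⟩ := hleb a' (hsub (left_mem_Icc.2 hab))
      refine (hsol t).mono fun y hy => ⟨?_, hsub hy⟩
      have hy' : L y ∈ Metric.ball a' δ := by
        rw [Metric.mem_ball]
        refine lt_of_le_of_lt ((dist_pi_le_iff (half_pos hδ).le).2 fun i => ?_) (half_lt_self hδ)
        rw [Real.dist_eq, abs_of_nonneg (sub_nonneg.2 (hy.1 i))]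
        linarith [hside i, hy.2 i]
      simpa using ht hy'
    · rw [Icc_eq_empty hab]
      exact ⟨fun _ _ => 0, fun i => by simp, by simp⟩
  · intro a' b' i c hac hcb h₁ h₂ hsub
    have hsub₁ : Icc a' (Function.update b' i c) ⊆ Icc a' b' :=
      Icc_subset_Icc_right (update_le_self_iff.2 hcb)
    have hsub₂ : Icc (Function.update a' i c) b' ⊆ Icc a' b' :=
      Icc_subset_Icc_left (le_update_self_iff.2 hac)
    have hun : L ⁻¹' Icc a' b' =
        L ⁻¹' Icc a' (Function.update b' i c) ∪ L ⁻¹' Icc (Function.update a' i c) b' := by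
      rw [← preimage_union]
      congr 1
      refine Subset.antisymm (fun x hx => ?_) (union_subset hsub₁ hsub₂)
      rcases le_total (x i) c with h | h
      · exact Or.inl ⟨hx.1, le_update_iff.2 ⟨h, fun l _ => hx.2 l⟩⟩
      · exact Or.inr ⟨update_le_iff.2 ⟨h, fun l _ => hx.1 l⟩, hx.2⟩
    have h₁ := h₁ (hsub₁.trans hsub)
    have h₂ := h₂ (hsub₂.trans hsub)
    rw [hun]
    -- The retraction onto the common face sets the `i`-th coordinate equal to `c`.
    refine HasCompletion.union (isClosed_Icc.preimage L.continuous)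
      (isClosed_Icc.preimage L.continuous) hf
      (fun l => (hj l).mono (hun ▸ preimage_mono hsub))
      (pr := fun t => L.symm (Function.update (L t) i c)) ?_ ?_ ?_ h₁ h₂
    · exact L.symm.continuous.comp (L.continuous.update i continuous_const)
    · intro t ht
      have ht' : L t ∈ Icc a' b' := hsub₂ ht
      have hle : c ≤ L t i := by simpa using ht.1 i
      refine ⟨?_, ?_⟩
      · simp only [mem_preimage, Homeomorph.apply_symm_apply]
        refine ⟨le_update_iff.2 ⟨hac, fun l _ => ht'.1 l⟩,
          update_le_update_iff.2 ⟨le_rfl, fun l _ => ht'.2 l⟩⟩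
      · simp only [mem_preimage, Homeomorph.apply_symm_apply]
        refine ⟨update_le_update_iff.2 ⟨le_rfl, fun l _ => ht'.1 l⟩,
          update_le_iff.2 ⟨hcb, fun l _ => ht'.2 l⟩⟩
    · intro t ht
      have h1 : L t i ≤ c := by simpa using ht.1.2 i
      have h2 : c ≤ L t i := by simpa using ht.2.1 i
      rw [le_antisymm h2 h1, Function.update_eq_self, L.symm_apply_apply]

/-- Completing the empty family trivializes the bundle over the box. -/
theorem exists_frame_box {N : ℕ} (L : T ≃ₜ (Fin N → ℝ)) (hf : Continuous f) (a b : Fin N → ℝ)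
    {m : ℕ} (hrank : ∀ t, Module.finrank 𝔽 (W.Fiber (f t)) = m) :
    ∃ e : ∀ t, Fin m → W.Fiber (f t),
      (∀ i, ContinuousOn (fun t => (⟨f t, e t i⟩ : W.Total)) (L ⁻¹' Icc a b)) ∧
      ∀ t ∈ L ⁻¹' Icc a b, IsFrame (𝔽 := 𝔽) (e t) := by
  obtain ⟨e, hc, he⟩ := hasCompletion_box (W := W) (k := m) (κ := Empty)
    (j := fun _ i => i.elim) L hf a b (fun i => i.elim) (fun _ _ => linearIndependent_empty_type)
    (fun t _ => by simpa using hrank t)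
  refine ⟨e, hc, fun t ht => ⟨(he t ht).1.comp Sum.inl Sum.inl_injective, ?_⟩⟩
  have := (he t ht).2
  rwa [Sum.elim_range, range_eq_empty (fun i : Empty => i.elim), union_empty] at this

end FVectorBundle

theorem IsCompact.exists_subset_box {H : Type*} [NormedAddCommGroup H] [NormedSpace ℝ H]
    [FiniteDimensional ℝ H] {K : Set H} (hK : IsCompact K) :
    ∃ (L : H ≃ₜ (Fin (Module.finrank ℝ H) → ℝ)) (a b : Fin (Module.finrank ℝ H) → ℝ),
      K ⊆ L ⁻¹' Icc a b := by
  let L : H ≃L[ℝ] (Fin (Module.finrank ℝ H) → ℝ) := ContinuousLinearEquiv.ofFinrankEq (by simp)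
  obtain ⟨R, hR⟩ := (hK.image L.continuous).isBounded.exists_norm_le
  refine ⟨L.toHomeomorph, fun _ => -R, fun _ => R, fun x hx => ?_⟩
  have h : ∀ i, |L x i| ≤ R := fun i => (norm_le_pi_norm (L x) i).trans (hR _ ⟨x, hx, rfl⟩)
  exact ⟨fun i => (abs_le.1 (h i)).1, fun i => (abs_le.1 (h i)).2⟩

/-! ### Extending sections over a relative CW-complex, cell by cell. -/

section Colimits

universe u' z

open Limits

/-- Every function is a morphism to a space with the trivial topology. -/
def TopCat.toTrivial {Y : TopCat.{u}} {R : Type u} (f : Y → R) : Y ⟶ TopCat.trivial.obj R :=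
  @TopCat.ofHom Y R _ ⊤ (@ContinuousMap.mk Y R _ ⊤ f continuous_top)

/-- Every function into an indiscrete space is continuous, so the universal property also applies to
plain functions. Passing to the shrunk union of the ranges moves the target into the universe of the
spaces. -/
theorem TopCat.exists_desc {J : Type*} [Category J] [Small.{u} J] {F : J ⥤ TopCat.{u}}
    {c : Cocone F} (hc : IsColimit c) {Z : Type z} (s : ∀ j, F.obj j → Z)
    (hs : ∀ {i j} (g : i ⟶ j) (x : F.obj i), s j (F.map g x) = s i x) :
    ∃ s' : c.pt → Z, ∀ j (x : F.obj j), s' (c.ι.app j x) = s j x := by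
  let R : Set Z := ⋃ j, range (s j)
  let q : R ≃ Shrink.{u} R := equivShrink R
  let g : ∀ j, F.obj j ⟶ TopCat.trivial.obj (Shrink.{u} R) := fun j =>
    TopCat.toTrivial fun x => q ⟨s j x, mem_iUnion.2 ⟨j, x, rfl⟩⟩
  let c' : Cocone F :=
    { pt := TopCat.trivial.obj (Shrink.{u} R)
      ι :=
      { app := g
        naturality := by
          intro i j h
          ext x
          change q _ = q _
          congr 2
          exact hs h x } }
  refine ⟨fun x => (q.symm (hc.desc c' x)).1, fun j x => ?_⟩
  have h1 : hc.desc c' (c.ι.app j x) = g j x := ConcreteCategory.congr_hom (hc.fac c' j) x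
  refine (congrArg (fun y : Shrink.{u} R => (q.symm y).1) h1).trans ?_
  change (q.symm (q _)).1 = _
  rw [Equiv.symm_apply_apply]

theorem TopCat.exists_rep_of_isColimit {J : Type*} [Category J] {F : J ⥤ TopCat.{u}}
    {c : Cocone F} (hc : IsColimit c) (x : c.pt) : ∃ j, ∃ y : F.obj j, c.ι.app j y = x := by
  by_contra h
  push Not at h
  let a : c.pt ⟶ TopCat.trivial.obj (ULift Prop) := TopCat.toTrivial fun y => ⟨y = x⟩
  let b : c.pt ⟶ TopCat.trivial.obj (ULift Prop) := TopCat.toTrivial fun y => ⟨False⟩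
  have hab : a = b := hc.hom_ext fun j => by
    refine ConcreteCategory.hom_ext _ _ fun y => ?_
    have h3 : (⟨c.ι.app j y = x⟩ : ULift Prop) = ⟨False⟩ := by simp [h j y]
    exact h3
  have h2 : (⟨x = x⟩ : ULift Prop) = ⟨False⟩ := ConcreteCategory.congr_hom hab x
  simp at h2

/-- A predicate on maps from topological spaces to a set that is stable under precomposition with
continuous maps and that can be checked on the pieces of a quotient. -/
structure GluingPredicate (Tot : Type z) where
  /-- The predicate. -/
  Good : ∀ {T : Type u} [TopologicalSpace T], (T → Tot) → Prop
  comp : ∀ {T T' : Type u} [TopologicalSpace T] [TopologicalSpace T'] {s : T → Tot} {g : T' → T},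
    Continuous g → Good s → Good (s ∘ g)
  glue : ∀ {ι : Type u} {T : ι → Type u} [∀ i, TopologicalSpace (T i)] {T' : Type u}
    [TopologicalSpace T'] {g : ∀ i, T i → T'} {s : T' → Tot},
    IsQuotientMap (fun p : Σ i, T i => g p.1 p.2) → (∀ i, Good (s ∘ g i)) → Good s

variable {Tot : Type z} (P : GluingPredicate.{u} Tot)

/-- The disjoint union of the pieces maps onto the colimit by a quotient map. -/
theorem GluingPredicate.good_of_isColimit {J : Type*} [Category J] [Small.{u} J]
    {F : J ⥤ TopCat.{u}} {c : Cocone F} (hc : IsColimit c) {s : c.pt → Tot}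
    (hs : ∀ j, P.Good (fun x : F.obj j => s (c.ι.app j x))) : P.Good s := by
  let e := equivShrink.{u} J
  refine P.glue (ι := Shrink.{u} J) (T := fun i => F.obj (e.symm i))
    (g := fun i x => c.ι.app (e.symm i) x) ?_ fun i => hs (e.symm i)
  rw [isQuotientMap_iff, isCoinducing_iff]
  refine ⟨fun U => ?_, fun x => ?_⟩
  · rw [TopCat.isOpen_iff_of_isColimit c hc, isOpen_sigma_iff]
    exact ⟨fun h j => by
      obtain ⟨i, rfl⟩ := e.symm.surjective j
      exact h i, fun h i => h (e.symm i)⟩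
  · obtain ⟨j, y, hy⟩ := TopCat.exists_rep_of_isColimit hc x
    obtain ⟨i, rfl⟩ := e.symm.surjective j
    exact ⟨⟨i, y⟩, hy⟩

open HomotopicalAlgebra

theorem GluingPredicate.exists_attachCells {α : Type*} {A B : α → TopCat.{u}} {g : ∀ a, A a ⟶ B a}
    {X₁ X₂ : TopCat.{u}} {f : X₁ ⟶ X₂} (c : AttachCells.{u} g f) {s₁ : X₁ → Tot} (h₁ : P.Good s₁)
    (sc : ∀ i : c.ι, B (c.π i) → Tot) (hsc : ∀ i, P.Good (sc i))
    (hcomp : ∀ i x, sc i (g (c.π i) x) = s₁ (c.g₁ (c.cofan₁.inj i x))) :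
    ∃ s₂ : X₂ → Tot, P.Good s₂ ∧ (∀ x, s₂ (f x) = s₁ x) ∧ ∀ i x, s₂ (c.cell i x) = sc i x := by
  obtain ⟨sd, hsd⟩ := TopCat.exists_desc c.isColimit₂ (fun ⟨i⟩ => sc i) (by
    rintro ⟨i⟩ ⟨j⟩ ⟨⟨h⟩⟩ x
    obtain rfl : i = j := h
    simp)
  have hsd' : ∀ i x, sd (c.cofan₂.inj i x) = sc i x := fun i x => hsd ⟨i⟩ x
  have hsdG : P.Good sd := P.good_of_isColimit c.isColimit₂ (fun ⟨i⟩ => by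
    have : (fun x => sd (c.cofan₂.ι.app ⟨i⟩ x)) = sc i := funext fun x => hsd' i x
    rw [this]
    exact hsc i)
  have hm : ∀ x, sd (c.m x) = s₁ (c.g₁ x) := by
    intro x
    obtain ⟨⟨i⟩, y, rfl⟩ := TopCat.exists_rep_of_isColimit c.isColimit₁ x
    have h2 : c.m (c.cofan₁.ι.app ⟨i⟩ y) = c.cofan₂.inj i (g (c.π i) y) :=
      ConcreteCategory.congr_hom (c.hm i) y
    rw [h2, hsd', hcomp]
    rfl
  obtain ⟨s₂, hs₂⟩ := TopCat.exists_desc c.isPushout.isColimit (Z := Tot)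
    (fun
      | none => fun x => s₁ (c.g₁ x)
      | some WalkingPair.left => s₁
      | some WalkingPair.right => sd) (by
    rintro _ _ (_ | ⟨_ | _⟩) x
    · simp
    · rfl
    · exact hm x)
  have hl : ∀ x, s₂ (f x) = s₁ x := fun x => hs₂ (some WalkingPair.left) x
  have hr : ∀ x, s₂ (c.g₂ x) = sd x := fun x => hs₂ (some WalkingPair.right) x
  refine ⟨s₂, ?_, hl, fun i x => ?_⟩
  · refine P.good_of_isColimit c.isPushout.isColimit ?_
    rintro (_ | _ | _)
    · refine (show (fun x => s₁ (c.g₁ x)) = _ from funext fun x => (hs₂ none x).symm) ▸ ?_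
      exact P.comp c.g₁.hom.continuous h₁
    · exact (show s₁ = _ from funext fun x => (hl x).symm) ▸ h₁
    · exact (show sd = _ from funext fun x => (hr x).symm) ▸ hsdG
  · rw [← hsd', ← hr]
    rfl

theorem AttachCells.exists_rep {α : Type*} {A B : α → TopCat.{u}} {g : ∀ a, A a ⟶ B a}
    {X₁ X₂ : TopCat.{u}} {f : X₁ ⟶ X₂} (c : AttachCells.{u} g f) (x : X₂) :
    (∃ y, f y = x) ∨ ∃ i y, c.cell i y = x := by
  obtain ⟨_ | _ | _, y, hy⟩ := TopCat.exists_rep_of_isColimit c.isPushout.isColimit x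
  · refine Or.inl ⟨c.g₁ y, ?_⟩
    rw [← hy]
    rfl
  · exact Or.inl ⟨y, hy⟩
  · obtain ⟨⟨i⟩, z, rfl⟩ := TopCat.exists_rep_of_isColimit c.isColimit₂ y
    exact Or.inr ⟨i, z, hy⟩

/-- The tower of attachments reduces extension over `X` to extension from the boundary sphere to the
disk. Sections are mere functions to `Tot` lying over `X`, and `P` carries the continuity. -/
theorem RelCWPair.exists_extension {X : Type u} [TopologicalSpace X] {A : Set X} (K : RelCWPair A)
    {d : ℕ} (hd : K.DimLE d) (pr : Tot → X)
    (ext : ∀ n ≤ d, ∀ (b : TopCat.disk.{u} n → X) (s : TopCat.diskBoundary.{u} n → Tot),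
      Continuous b → P.Good s → (∀ x, pr (s x) = b (TopCat.diskBoundaryInclusion n x)) →
      ∃ s' : TopCat.disk.{u} n → Tot, P.Good s' ∧ (∀ x, pr (s' x) = b x) ∧
        ∀ x, s' (TopCat.diskBoundaryInclusion n x) = s x)
    (sA : A → Tot) (hsA : P.Good sA) (hprA : ∀ a, pr (sA a) = a) :
    ∃ s : X → Tot, P.Good s ∧ (∀ x, pr (s x) = x) ∧ ∀ a : A, s a = sA a := by
  let F := K.F
  -- Stage `n` contains only cells of dimension less than `n`; the `n`-cells are attached in passing
  -- to stage `n + 1`.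
  let S (n : ℕ) := {s : F.obj n → Tot // P.Good s ∧ ∀ x, pr (s x) = K.incl.app n x}
  have step : ∀ n (s : S n), ∃ s' : S (n + 1),
      ∀ x, s'.1 (F.map (homOfLE (Order.le_succ n)) x) = s.1 x := by
    intro n ⟨s, hs, hprs⟩
    let c := K.attachCells n (not_isMax n)
    have hin : ∀ x, K.incl.app (n + 1) (F.map (homOfLE (Order.le_succ n)) x) = K.incl.app n x := by
      intro x
      have := K.incl.naturality (homOfLE (Order.le_succ n))
      exact ConcreteCategory.congr_hom this x
    have hcell : ∀ i : c.ι, ∀ x, c.cell i (TopCat.diskBoundaryInclusion n x) =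
        F.map (homOfLE (Order.le_succ n)) (c.g₁ (c.cofan₁.inj i x)) := by
      intro i x
      have h1 := ConcreteCategory.congr_hom (c.hm i) x
      have h2 := ConcreteCategory.congr_hom c.isPushout.w (c.cofan₁.inj i x)
      refine Eq.trans ?_ h2.symm
      exact congrArg c.g₂ h1.symm
    have hext : ∀ i : c.ι, ∃ s' : TopCat.disk.{u} n → Tot, P.Good s' ∧
        (∀ x, pr (s' x) = K.incl.app (n + 1) (c.cell i x)) ∧
        ∀ x, s' (TopCat.diskBoundaryInclusion n x) = s (c.g₁ (c.cofan₁.inj i x)) := by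
      intro i
      refine ext n (hd ⟨n, not_isMax n, i⟩) (fun x => K.incl.app (n + 1) (c.cell i x))
        (fun x => s (c.g₁ (c.cofan₁.inj i x))) ?_ ?_ ?_
      · exact (K.incl.app (n + 1)).hom.continuous.comp (c.cell i).hom.continuous
      · exact P.comp (c.g₁.hom.continuous.comp (c.cofan₁.inj i).hom.continuous) hs
      · intro x
        rw [hprs, hcell, hin]
    choose sc hscG hscp hscb using hext
    obtain ⟨s', hs'G, hs'f, hs'c⟩ := P.exists_attachCells c hs sc hscG hscb
    refine ⟨⟨s', hs'G, fun x => ?_⟩, hs'f⟩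
    rcases AttachCells.exists_rep c x with ⟨y, rfl⟩ | ⟨i, y, rfl⟩
    · rw [hs'f, hprs]
      exact (hin y).symm
    · rw [hs'c]
      exact hscp i y
  choose next hnext using step
  have hbot : ∀ x, K.incl.app ⊥ x = (K.isoBot.hom x : A).1 := by
    intro x
    have h := ConcreteCategory.congr_hom K.fac (K.isoBot.hom x)
    have h2 : K.isoBot.inv (K.isoBot.hom x) = x := ConcreteCategory.congr_hom K.isoBot.hom_inv_id x
    have h3 : K.incl.app ⊥ (K.isoBot.inv (K.isoBot.hom x)) = (K.isoBot.hom x : A).1 := h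
    rwa [h2] at h3
  let s0 : S 0 := ⟨fun x => sA (K.isoBot.hom x),
    P.comp K.isoBot.hom.hom.continuous hsA, fun x => (hprA _).trans (hbot x).symm⟩
  let sn : ∀ n, S n := fun n => Nat.rec s0 next n
  have hsn : ∀ n x, (sn (n + 1)).1 (F.map (homOfLE (Order.le_succ n)) x) = (sn n).1 x :=
    fun n x => hnext n (sn n) x
  have hcompat : ∀ i k (h : i ≤ i + k) x, (sn (i + k)).1 (F.map (homOfLE h) x) = (sn i).1 x := by
    intro i k
    induction k with
    | zero =>
      intro h x
      have : F.map (homOfLE h) = 𝟙 (F.obj i) := F.map_id i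
      rw [this]
      rfl
    | succ k ih =>
      intro h x
      have h1 : F.map (homOfLE h) =
          F.map (homOfLE (Nat.le_add_right i k)) ≫ F.map (homOfLE (Order.le_succ (i + k))) := by
        rw [← F.map_comp]
        rfl
      rw [h1, ← ih (Nat.le_add_right i k) x]
      exact hsn (i + k) _
  obtain ⟨s, hs⟩ := TopCat.exists_desc K.isColimit (fun n => (sn n).1) (by
    intro i j g x
    obtain ⟨k, rfl⟩ := Nat.exists_eq_add_of_le (leOfHom g)
    exact hcompat i k (leOfHom g) x)
  refine ⟨s, ?_, fun x => ?_, fun a => ?_⟩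
  · refine P.good_of_isColimit K.isColimit fun n => ?_
    rw [show (fun x => s ((Cocone.mk _ K.incl).ι.app n x)) = (sn n).1 from funext (hs n)]
    exact (sn n).2.1
  · obtain ⟨n, y, rfl⟩ := TopCat.exists_rep_of_isColimit K.isColimit x
    rw [hs]
    exact (sn n).2.2 y
  · have h1 : K.incl.app ⊥ (K.isoBot.inv a) = a.1 := ConcreteCategory.congr_hom K.fac a
    have h2 : K.isoBot.hom (K.isoBot.inv a) = a := ConcreteCategory.congr_hom K.isoBot.inv_hom_id a
    have h3 := hs 0 (K.isoBot.inv a)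
    have h4 : (sn 0).1 (K.isoBot.inv a) = sA (K.isoBot.hom (K.isoBot.inv a)) := rfl
    rw [h4, h2] at h3
    rw [← h3]
    exact congrArg s h1.symm

end Colimits

/-! ### Linear maps prescribed on a frame. -/

section Algebra

variable {𝔽 : Type*} [DivisionRing 𝔽] {M N κ : Type*} [AddCommGroup M] [Module 𝔽 M]
  [AddCommGroup N] [Module 𝔽 N] {e : κ → M}

theorem IsFrame.exists_linearMap (he : IsFrame (𝔽 := 𝔽) e) (y : κ → N) :
    ∃ L : M →ₗ[𝔽] N, ∀ i, L (e i) = y i := by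
  refine ⟨(Module.Basis.mk he.1 he.2).constr ℕ y, fun i => ?_⟩
  have := (Module.Basis.mk he.1 he.2).constr_basis ℕ y i
  rwa [Module.Basis.mk_apply] at this

theorem IsFrame.linearMap_ext (he : IsFrame (𝔽 := 𝔽) e) {L L' : M →ₗ[𝔽] N}
    (h : ∀ i, L (e i) = L' (e i)) : L = L' :=
  (Module.Basis.mk he.1 he.2).ext fun i => by simpa using h i

theorem IsFrame.injective_iff (he : IsFrame (𝔽 := 𝔽) e) (L : M →ₗ[𝔽] N) :
    Function.Injective L ↔ LinearIndependent 𝔽 fun i => L (e i) := by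
  refine ⟨fun h => he.1.map_injOn L h.injOn, fun h => ?_⟩
  let b := Module.Basis.mk he.1 he.2
  rw [← LinearMap.ker_eq_bot, LinearMap.ker_eq_bot']
  intro m hm
  have h1 : Finsupp.linearCombination 𝔽 (fun i => L (e i)) (b.repr m) = 0 := by
    have h2 := congrArg L (b.linearCombination_repr m)
    rw [hm, Finsupp.apply_linearCombination] at h2
    rw [← h2]
    congr 1
    ext i
    simp [b]
  have h3 := linearIndependent_iff.1 h _ h1
  simpa using h3

theorem IsFrame.map_bijective (he : IsFrame (𝔽 := 𝔽) e) {L : M →ₗ[𝔽] N}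
    (hL : Function.Bijective L) : IsFrame (𝔽 := 𝔽) fun i => L (e i) := by
  refine ⟨(he.injective_iff L).1 hL.1, ?_⟩
  change ⊤ ≤ Submodule.span 𝔽 (range (L ∘ e))
  rw [range_comp, Submodule.span_image, top_le_iff.1 he.2, Submodule.map_top,
    LinearMap.range_eq_top.2 hL.2]

theorem IsFrame.bijective_of_map (he : IsFrame (𝔽 := 𝔽) e) {L : M →ₗ[𝔽] N}
    (h : IsFrame (𝔽 := 𝔽) fun i => L (e i)) : Function.Bijective L := by
  refine ⟨(he.injective_iff L).2 h.1, ?_⟩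
  rw [← LinearMap.range_eq_top, ← top_le_iff]
  refine h.2.trans (Submodule.span_le.2 ?_)
  rintro _ ⟨i, rfl⟩
  exact ⟨_, rfl⟩

end Algebra

/-! ### Continuous families of linear maps, and their extension over cells. -/

namespace FVectorBundle

section Families

variable {𝔽 : Type w} [NormedDivisionRing 𝔽] {X : Type u} [TopologicalSpace X]
  {V : FVectorBundle.{u, v₁} 𝔽 X} {E : FVectorBundle.{u, v₂} 𝔽 X}
  {Z : Type*} [TopologicalSpace Z]
  {T : Type*} [TopologicalSpace T] {T' : Type*} [TopologicalSpace T']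

/-- Continuity of a family of linear maps between the fibres of two bundles along a map to the base,
depending on an additional parameter in `Z`. -/
def IsContinuousFamily {f : T → X} (L : ∀ t, Z → V.Fiber (f t) →ₗ[𝔽] E.Fiber (f t)) : Prop :=
  Continuous f ∧ ∀ (U : Set X) (v : ∀ x, V.Fiber x), IsOpen U →
    ContinuousOn (fun x => (⟨x, v x⟩ : V.Total)) U →
    ContinuousOn (fun p : T × Z => (⟨f p.1, L p.1 p.2 (v (f p.1))⟩ : E.Total)) {p | f p.1 ∈ U}

theorem IsContinuousFamily.comp {f : T → X} {L : ∀ t, Z → V.Fiber (f t) →ₗ[𝔽] E.Fiber (f t)}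
    (h : IsContinuousFamily L) {g : T' → T} (hg : Continuous g) :
    IsContinuousFamily (f := fun t => f (g t)) fun t => L (g t) := by
  refine ⟨h.1.comp hg, fun U v hU hv => ?_⟩
  have h1 : Continuous fun p : T' × Z => (g p.1, p.2) := by fun_prop
  exact (h.2 U v hU hv).comp h1.continuousOn fun p hp => hp

/-- The definition tests only sections pulled back from open sets of `X`. A chart provides a frame
of such sections, and an arbitrary continuous `v` has continuous coefficients in it. -/
theorem IsContinuousFamily.continuousWithinAt_apply {f : T → X}
    {L : ∀ t, Z → V.Fiber (f t) →ₗ[𝔽] E.Fiber (f t)} (h : IsContinuousFamily L)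
    {p : T' → T × Z} {S : Set T'} {t' : T'} (hp : ContinuousWithinAt p S t')
    {v : ∀ t', V.Fiber (f (p t').1)}
    (hv : ContinuousWithinAt (fun t' => (⟨f (p t').1, v t'⟩ : V.Total)) S t') :
    ContinuousWithinAt
      (fun t' => (⟨f (p t').1, L (p t').1 (p t').2 (v t')⟩ : E.Total)) S t' := by
  classical
  obtain ⟨C, hC⟩ := V.exists_localChart (f (p t').1)
  have hf : ContinuousWithinAt (fun t' => f (p t').1) S t' :=
    (h.1.comp continuous_fst).continuousAt.comp_continuousWithinAt hp
  let e : Fin C.n → ∀ x, V.Fiber x := fun i x => C.ψ x (Pi.single i 1)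
  have hsum : ∀ x ∈ C.U, ∀ v : V.Fiber x, v = ∑ i, C.φ x v i • e i x := by
    intro x hx v
    conv_lhs => rw [← C.ψ_φ x hx v, pi_eq_sum_univ' (C.φ x v)]
    simp only [map_sum, map_smul, e]
  have he : ∀ i, ContinuousOn (fun x => (⟨x, e i x⟩ : V.Total)) C.U := fun i =>
    C.continuousOn_ψ.comp (f := fun x => (x, (Pi.single i 1 : Fin C.n → 𝔽)))
      (by fun_prop) fun x hx => hx
  have hLe : ∀ i, ContinuousWithinAt
      (fun t' => (⟨f (p t').1, L (p t').1 (p t').2 (e i _)⟩ : E.Total)) S t' := fun i => by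
    have h1 := (h.2 C.U (e i) C.isOpen (he i)).continuousAt
      ((C.isOpen.preimage (h.1.comp continuous_fst)).mem_nhds hC)
    exact ContinuousAt.comp_continuousWithinAt h1 hp
  have h2 := continuousWithinAt_sum (E := E) (κ := Fin C.n) hf hLe
    ((C.continuousWithinAt_iff hf hC).1 hv)
  have heq : ∀ t', f (p t').1 ∈ C.U → (⟨f (p t').1, L (p t').1 (p t').2 (v t')⟩ : E.Total) =
      ⟨f (p t').1, ∑ i, C.φ (f (p t').1) (v t') i • L (p t').1 (p t').2 (e i _)⟩ := by
    intro t' ht'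
    congr 1
    conv_lhs => rw [hsum _ ht' (v t')]
    simp only [map_sum, map_smul]
  exact h2.congr_of_eventuallyEq (by
    filter_upwards [hf (C.isOpen.mem_nhds hC)] with t'' ht''
    exact heq t'' ht'') (heq t' hC)

theorem IsContinuousFamily.of_hom {φ : ∀ x, V.Fiber x →ₗ[𝔽] E.Fiber x}
    (hφ : Continuous fun p : V.Total => (⟨p.proj, φ p.proj p.snd⟩ : E.Total)) :
    IsContinuousFamily (Z := Z) (f := fun x : X => x) fun x _ => φ x := by
  refine ⟨continuous_id, fun U v hU hv => ?_⟩
  exact (hφ.comp_continuousOn hv).comp continuous_fst.continuousOn fun p hp => hp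

theorem IsContinuousFamily.of_frame [NormedAlgebra ℝ 𝔽] [FiniteDimensional ℝ 𝔽] {κ : Type*}
    [Fintype κ] {f : T → X} (hf : Continuous f)
    {L : ∀ t, Z → V.Fiber (f t) →ₗ[𝔽] E.Fiber (f t)} {e : ∀ t, κ → V.Fiber (f t)}
    (he : ∀ i, Continuous fun t => (⟨f t, e t i⟩ : V.Total))
    (hframe : ∀ t, IsFrame (𝔽 := 𝔽) (e t))
    (hL : ∀ i, Continuous fun p : T × Z => (⟨f p.1, L p.1 p.2 (e p.1 i)⟩ : E.Total)) :
    IsContinuousFamily L := by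
  refine ⟨hf, fun U v hU hv => ?_⟩
  choose a ha using fun t => (hframe t).exists_sum_eq (v (f t))
  have hac : ContinuousOn a (f ⁻¹' U) := fun t ht =>
    continuousWithinAt_coeff (E := V) hf.continuousWithinAt (fun i => (he i).continuousWithinAt)
      (hframe t) (σ := fun t => v (f t)) (hv.comp hf.continuousOn (fun _ h => h) t ht) ht
      fun t _ => ha t
  intro p hp
  have h1 := continuousWithinAt_sum (E := E) (S := {p : T × Z | f p.1 ∈ U}) (t := p)
    (f := fun p => f p.1)
    (hf.comp continuous_fst).continuousWithinAt (fun i => (hL i).continuousWithinAt)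
    (a := fun p => a p.1)
    (hac.comp (s := {p : T × Z | f p.1 ∈ U}) continuous_fst.continuousOn (fun _ h => h) p hp)
  have heq : ∀ p : T × Z, (⟨f p.1, L p.1 p.2 (v (f p.1))⟩ : E.Total) =
      ⟨f p.1, ∑ i, a p.1 i • L p.1 p.2 (e p.1 i)⟩ := by
    intro p
    rw [← ha p.1]
    simp only [map_sum, map_smul]
  simpa only [heq] using h1

/-- Open sets are continuous maps to the Sierpiński space `Prop`, and by local compactness of `Z`
these descend along `q × id`. -/
theorem _root_.Topology.IsQuotientMap.prodMap_id [LocallyCompactSpace Z] {q : T' → T}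
    (hq : IsQuotientMap q) :
    IsQuotientMap (fun p : T' × Z => (q p.1, p.2)) := by
  rw [isQuotientMap_iff, isCoinducing_iff]
  refine ⟨fun U => ⟨fun h => ?_, fun h => ?_⟩, fun ⟨t, z⟩ => ?_⟩
  · have h1 : Continuous fun p : T × Z => p ∈ U :=
      hq.continuous_lift_prod_left (continuous_Prop.2 h)
    exact continuous_Prop.1 h1
  · exact h.preimage ((hq.continuous.comp continuous_fst).prodMk continuous_snd)
  · obtain ⟨t', rfl⟩ := hq.surjective t
    exact ⟨(t', z), rfl⟩

theorem IsContinuousFamily.of_isQuotientMap [LocallyCompactSpace Z] {ι : Type*} {Y : ι → Type*}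
    [∀ i, TopologicalSpace (Y i)] {g : ∀ i, Y i → T}
    (hg : IsQuotientMap fun p : Σ i, Y i => g p.1 p.2) {f : T → X}
    {L : ∀ t, Z → V.Fiber (f t) →ₗ[𝔽] E.Fiber (f t)}
    (h : ∀ i, IsContinuousFamily (f := fun y => f (g i y)) fun y => L (g i y)) :
    IsContinuousFamily L := by
  have hf : Continuous f := hg.continuous_iff.2 (continuous_sigma fun i => (h i).1)
  refine ⟨hf, fun U v hU hv => ?_⟩
  have hW : IsOpen {p : T × Z | f p.1 ∈ U} := hU.preimage (hf.comp continuous_fst)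
  rw [(hg.prodMap_id (Z := Z)).continuousOn_isOpen_iff hW]
  rintro ⟨⟨i, y⟩, z⟩ hp
  have h1 := (h i).2 U v hU hv
  have h2 := h1.continuousAt (x := (y, z)) (((hU.preimage (h i).1).preimage
    continuous_fst).mem_nhds hp)
  have hemb : IsOpenEmbedding (fun p : Y i × Z => ((⟨i, p.1⟩, p.2) : (Σ i, Y i) × Z)) :=
    IsOpenEmbedding.sigmaMk.prodMap IsOpenEmbedding.id
  exact (hemb.continuousAt_iff (g := fun p : (Σ i, Y i) × Z =>
    (⟨f (g p.1.1 p.1.2), L (g p.1.1 p.1.2) p.2 (v _)⟩ : E.Total)).1 h2).continuousWithinAt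

end Families

section Extension

variable {𝔽 : Type w} [NormedDivisionRing 𝔽] {X : Type u} [TopologicalSpace X]
  {V : FVectorBundle.{u, v₁} 𝔽 X} {E : FVectorBundle.{u, v₂} 𝔽 X}
  {Z : Type*} [TopologicalSpace Z] [LocallyCompactSpace Z]

/-- Continuous families of linear maps satisfying a pointwise condition. -/
def familyPredicate (V : FVectorBundle.{u, v₁} 𝔽 X) (E : FVectorBundle.{u, v₂} 𝔽 X)
    (C : (Σ x, Z → V.Fiber x →ₗ[𝔽] E.Fiber x) → Prop) :
    GluingPredicate.{u} (Σ x, Z → V.Fiber x →ₗ[𝔽] E.Fiber x) where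
  Good s := IsContinuousFamily (f := fun t => (s t).1) (fun t => (s t).2) ∧ ∀ t, C (s t)
  comp hg hs := ⟨hs.1.comp hg, fun t => hs.2 _⟩
  glue hg hs := ⟨.of_isQuotientMap hg fun i => (hs i).1, fun t => by
    obtain ⟨⟨i, y⟩, rfl⟩ := hg.surjective t
    exact (hs i).2 y⟩

/-- Precomposing with the radial retraction onto the ball defines the map on all of Euclidean space,
where the results on boxes apply. -/
theorem exists_continuous_extension_disk {n : ℕ} {b : TopCat.disk.{u} n → X} (hb : Continuous b) :
    ∃ f : EuclideanSpace ℝ (Fin n) → X, Continuous f ∧ b = fun y => f y.down.1 := by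
  let r : EuclideanSpace ℝ (Fin n) → EuclideanSpace ℝ (Fin n) := fun x => (max 1 ‖x‖)⁻¹ • x
  have hpos : ∀ x : EuclideanSpace ℝ (Fin n), 0 < max 1 ‖x‖ := fun x =>
    lt_max_of_lt_left one_pos
  have hr : Continuous r := by
    have : Continuous fun x : EuclideanSpace ℝ (Fin n) => (max 1 ‖x‖)⁻¹ :=
      (continuous_const.max continuous_norm).inv₀ fun x => (hpos x).ne'
    exact this.smul continuous_id
  have hmem : ∀ x, r x ∈ Metric.closedBall (0 : EuclideanSpace ℝ (Fin n)) 1 := by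
    intro x
    rw [mem_closedBall_zero_iff, norm_smul, norm_inv, Real.norm_of_nonneg (hpos x).le,
      inv_mul_le_one₀ (hpos x)]
    exact le_max_right _ _
  refine ⟨fun x => b (ULift.up ⟨r x, hmem x⟩),
    hb.comp (continuous_uliftUp.comp (hr.subtype_mk hmem)), funext fun y => ?_⟩
  have hy : ‖y.down.1‖ ≤ 1 := mem_closedBall_zero_iff.1 y.down.2
  have : r y.down.1 = y.down.1 := by simp [r, max_eq_left hy]
  congr 1
  exact ULift.ext _ _ (Subtype.ext this.symm)

/-- `B` is meant to be the locus where the rank condition fails. Being clopen, it contains a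
connected disk entirely or misses it, so the extension problem has to be solved only off `B`. -/
theorem exists_family_extension {A : Set X} (K : RelCWPair A) {d : ℕ} (hd : K.DimLE d)
    {B : Set X} (hB : IsClopen B) (hBA : B ⊆ A)
    (C : ∀ x, (Z → V.Fiber x →ₗ[𝔽] E.Fiber x) → Prop)
    (ext : ∀ n ≤ d, ∀ f : EuclideanSpace ℝ (Fin n) → X, Continuous f → (∀ x, f x ∉ B) →
      ∀ L : ∀ x, Z → V.Fiber (f x) →ₗ[𝔽] E.Fiber (f x),
      IsContinuousFamily (T := Metric.sphere (0 : EuclideanSpace ℝ (Fin n)) 1)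
        (f := fun t => f t) (fun t => L t) →
      (∀ x ∈ Metric.sphere 0 1, C (f x) (L x)) →
      ∃ L' : ∀ x, Z → V.Fiber (f x) →ₗ[𝔽] E.Fiber (f x),
        IsContinuousFamily (T := Metric.closedBall (0 : EuclideanSpace ℝ (Fin n)) 1)
          (f := fun t => f t) (fun t => L' t) ∧
        (∀ x ∈ Metric.closedBall 0 1, C (f x) (L' x)) ∧ ∀ x ∈ Metric.sphere 0 1, L' x = L x)
    (LA : ∀ a : A, Z → V.Fiber a →ₗ[𝔽] E.Fiber a)
    (hLA : IsContinuousFamily (f := fun a : A => (a : X)) LA) (hCA : ∀ a : A, C a (LA a)) :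
    ∃ L : ∀ x, Z → V.Fiber x →ₗ[𝔽] E.Fiber x,
      IsContinuousFamily (f := fun x => x) L ∧ (∀ x, C x (L x)) ∧ ∀ a : A, L a = LA a := by
  let sA : A → Σ x, Z → V.Fiber x →ₗ[𝔽] E.Fiber x := fun a => ⟨a, LA a⟩
  -- Over `B`, which lies in `A`, the family is forced to equal the given one. For a disk inside
  -- `B`, the given family is therefore an extension that agrees with the boundary data.
  let P := familyPredicate V E (Z := Z)
    fun τ => C τ.1 τ.2 ∧ ∀ h : τ.1 ∈ B, τ = sA ⟨τ.1, hBA h⟩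
  obtain ⟨s, hs, hsp, hsA⟩ := K.exists_extension P hd Sigma.fst (by
    intro n hn b s hb hs hsb
    by_cases hbB : ∀ y, b y ∉ B
    · obtain ⟨f, hf, rfl⟩ := exists_continuous_extension_disk hb
      have hfs : ∀ x : EuclideanSpace ℝ (Fin n), ∃ L : Z → V.Fiber (f x) →ₗ[𝔽] E.Fiber (f x),
          ∀ hx : x ∈ Metric.sphere 0 1, s ⟨⟨x, hx⟩⟩ = ⟨f x, L⟩ := by
        intro x
        by_cases hx : x ∈ Metric.sphere 0 1
        · have h1 : (s ⟨⟨x, hx⟩⟩).1 = f x := hsb ⟨⟨x, hx⟩⟩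
          have h2 : ∃ L : Z → V.Fiber (f x) →ₗ[𝔽] E.Fiber (f x), s ⟨⟨x, hx⟩⟩ = ⟨f x, L⟩ := by
            rw [← h1]
            exact ⟨_, rfl⟩
          exact h2.imp fun L hL _ => hL
        · exact ⟨0, fun h => absurd h hx⟩
      choose L hL using hfs
      obtain rfl : s = fun t => ⟨f t.down.1, L t.down.1⟩ := funext fun t => hL t.down.1 t.down.2
      have hfB : ∀ x, ‖x‖ ≤ 1 → f x ∉ B := fun x hx =>
        hbB ⟨⟨x, mem_closedBall_zero_iff.2 hx⟩⟩
      have hfB' : ∀ x, f x ∉ B := by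
        intro x hx
        have h1 : f ⁻¹' B = univ := (hB.preimage hf).eq_univ ⟨x, hx⟩
        exact hfB 0 (by simp) (eq_univ_iff_forall.1 h1 0)
      obtain ⟨L', hL'c, hL'C, hL'L⟩ := ext n hn f hf hfB' L (hs.1.comp continuous_uliftUp)
        fun x hx => (hs.2 ⟨⟨x, hx⟩⟩).1
      refine ⟨fun y => ⟨f y.down.1, L' y.down.1⟩, ⟨hL'c.comp continuous_uliftDown, fun y =>
        ⟨hL'C y.down.1 y.down.2, fun h => absurd h (hfB' _)⟩⟩, fun _ => rfl, fun t => ?_⟩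
      change (⟨f t.down.1, L' t.down.1⟩ : Σ x, Z → V.Fiber x →ₗ[𝔽] E.Fiber x) = _
      rw [hL'L _ t.down.2]
    · push Not at hbB
      have hall : ∀ y, b y ∈ B := by
        have : PreconnectedSpace (TopCat.disk.{u} n) := by
          have h1 : IsPreconnected (Metric.closedBall (0 : EuclideanSpace ℝ (Fin n)) 1) :=
            (convex_closedBall 0 1).isPreconnected
          have := isPreconnected_iff_preconnectedSpace.1 h1
          exact (ULift.up_surjective.denseRange).preconnectedSpace continuous_uliftUp
        intro y
        have h1 : b ⁻¹' B = univ := (hB.preimage hb).eq_univ hbB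
        exact eq_univ_iff_forall.1 h1 y
      refine ⟨fun y => sA ⟨b y, hBA (hall y)⟩,
        ⟨?_, fun y => ⟨hCA ⟨b y, hBA (hall y)⟩, fun h => rfl⟩⟩, fun y => rfl, fun t => ?_⟩
      · exact hLA.comp (hb.subtype_mk fun y => hBA (hall y))
      · have h1 : (s t).1 ∈ B := hsb t ▸ hall _
        rw [(hs.2 t).2 h1]
        exact congrArg sA (Subtype.ext (hsb t).symm)) sA
    ⟨hLA, fun a => ⟨hCA a, fun h => rfl⟩⟩ (fun a => rfl)
  have hL : ∀ x, ∃ L : Z → V.Fiber x →ₗ[𝔽] E.Fiber x, s x = ⟨x, L⟩ := by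
    intro x
    have h1 : (s x).1 = x := hsp x
    generalize s x = τ at h1
    subst h1
    exact ⟨_, rfl⟩
  choose L hL using hL
  obtain rfl : s = fun x => ⟨x, L x⟩ := funext hL
  refine ⟨L, hs.1, fun x => (hs.2 x).1, fun a => ?_⟩
  have h1 := hsA a
  simpa [sA] using h1

end Extension

end FVectorBundle

/-! ### Extension of injective bundle maps. -/

namespace FVectorBundle

variable {𝔽 : Type w} [NormedDivisionRing 𝔽] {X : Type u} [TopologicalSpace X]

section Euclidean

variable {V : FVectorBundle.{u, v₁} 𝔽 X} {E : FVectorBundle.{u, v₂} 𝔽 X}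

theorem finrank_fiber_eq_of_preconnected {H : Type*} [TopologicalSpace H] [PreconnectedSpace H]
    {f : H → X} (hf : Continuous f) (x y : H) :
    Module.finrank 𝔽 (V.Fiber (f x)) = Module.finrank 𝔽 (V.Fiber (f y)) :=
  (V.isLocallyConstant_finrank.comp_continuous hf).apply_eq_of_preconnectedSpace x y

theorem IsContinuousFamily.continuousOn_apply {H Y : Type*} [TopologicalSpace H]
    [TopologicalSpace Y] {Z : Type*} [TopologicalSpace Z] {S : Set H}
    {f : H → X} {L : ∀ x, Z → V.Fiber (f x) →ₗ[𝔽] E.Fiber (f x)}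
    (hL : IsContinuousFamily (T := S) (f := fun t => f t) fun t => L t) {R : Set Y}
    {g : Y → H} (hg : ContinuousOn g R) (hgS : MapsTo g R S) {τ : Y → Z} (hτ : ContinuousOn τ R)
    {σ : ∀ y, V.Fiber (f (g y))}
    (hσ : ContinuousOn (fun y => (⟨f (g y), σ y⟩ : V.Total)) R) :
    ContinuousOn (fun y => (⟨f (g y), L (g y) (τ y) (σ y)⟩ : E.Total)) R := by
  rw [continuousOn_iff_continuous_domRestrict] at *
  rw [← continuousOn_univ]
  intro y _
  exact hL.continuousWithinAt_apply (T' := R)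
    (p := fun y => ((⟨g y, hgS y.2⟩ : S), τ y)) (v := fun y => σ y)
    ((hg.subtype_mk fun y => hgS y.2).prodMk hτ).continuousWithinAt hσ.continuousWithinAt

variable [NormedAlgebra ℝ 𝔽] [FiniteDimensional ℝ 𝔽]

/-- In frames of both bundles over a box containing the ball, injectivity means that the coefficient
matrix has independent rows, so the matrix extension result applies. -/
theorem exists_injective_extension_closedBall {n k m : ℕ}
    (hdim : k = 0 ∨ n + Module.finrank ℝ 𝔽 * k < Module.finrank ℝ 𝔽 * (m + 1))
    {f : EuclideanSpace ℝ (Fin n) → X} (hf : Continuous f)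
    (hV : ∀ x, Module.finrank 𝔽 (V.Fiber (f x)) = k)
    (hE : ∀ x, Module.finrank 𝔽 (E.Fiber (f x)) = m)
    {L : ∀ x, Unit → V.Fiber (f x) →ₗ[𝔽] E.Fiber (f x)}
    (hL : IsContinuousFamily (T := Metric.sphere (0 : EuclideanSpace ℝ (Fin n)) 1)
      (f := fun t => f t) fun t => L t)
    (hinj : ∀ x ∈ Metric.sphere 0 1, Function.Injective (L x ())) :
    ∃ L' : ∀ x, Unit → V.Fiber (f x) →ₗ[𝔽] E.Fiber (f x),
      IsContinuousFamily (T := Metric.closedBall (0 : EuclideanSpace ℝ (Fin n)) 1)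
        (f := fun t => f t) (fun t => L' t) ∧
      (∀ x ∈ Metric.closedBall 0 1, Function.Injective (L' x ())) ∧
      ∀ x ∈ Metric.sphere 0 1, L' x = L x := by
  have hsub : Metric.sphere (0 : EuclideanSpace ℝ (Fin n)) 1 ⊆ Metric.closedBall 0 1 :=
    Metric.sphere_subset_closedBall
  obtain ⟨Λ, a, b, hbox⟩ :=
    (isCompact_closedBall (0 : EuclideanSpace ℝ (Fin n)) 1).exists_subset_box
  obtain ⟨eV, heVc, heV⟩ := exists_frame_box Λ hf a b hV
  obtain ⟨eE, heEc, heE⟩ := exists_frame_box Λ hf a b hE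
  replace heVc := fun i => (heVc i).mono hbox
  replace heEc := fun i => (heEc i).mono hbox
  replace heV := fun x hx => heV x (hbox hx)
  replace heE := fun x hx => heE x (hbox hx)
  have hLe : ∀ i, ContinuousOn (fun x => (⟨f x, L x () (eV x i)⟩ : E.Total))
      (Metric.sphere 0 1) := fun i =>
    hL.continuousOn_apply continuousOn_id (fun _ h => h) continuousOn_const ((heVc i).mono hsub)
  obtain ⟨M, hMc, hM⟩ := exists_continuousOn_coeff (W := E) hf (fun s => (heEc s).mono hsub)
    (fun x hx => heE x (hsub hx)) hLe
  have hMLI : ∀ x ∈ Metric.sphere 0 1, LinearIndependent 𝔽 (M x) := by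
    intro x hx
    rw [← (heE x (hsub hx)).linearIndependent_sum_smul_iff]
    simp only [hM x hx]
    exact ((heV x (hsub hx)).injective_iff _).1 (hinj x hx)
  obtain ⟨M', hM'c, hM'M, hM'LI⟩ := exists_extension_linearIndependent (by simpa using hdim)
    (isCompact_sphere (0 : EuclideanSpace ℝ (Fin n)) 1) hMc hMLI
  have hL' : ∀ x, ∃ L' : V.Fiber (f x) →ₗ[𝔽] E.Fiber (f x), x ∈ Metric.closedBall 0 1 →
      ∀ i, L' (eV x i) = ∑ s, M' x i s • eE x s := by
    intro x
    by_cases hx : x ∈ Metric.closedBall 0 1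
    · obtain ⟨L', hL'⟩ := (heV x hx).exists_linearMap fun i => ∑ s, M' x i s • eE x s
      exact ⟨L', fun _ => hL'⟩
    · exact ⟨0, fun h => absurd h hx⟩
  choose L' hL' using hL'
  refine ⟨fun x _ => L' x, ?_, fun x hx => ?_, fun x hx => ?_⟩
  · refine IsContinuousFamily.of_frame (hf.comp continuous_subtype_val) (e := fun t => eV t)
      (fun i => (heVc i).domRestrict) (fun t => heV t t.2) fun i => ?_
    have h1 : ContinuousOn (fun x => (⟨f x, ∑ s, M' x i s • eE x s⟩ : E.Total))
        (Metric.closedBall 0 1) := fun x hx =>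
      continuousWithinAt_sum hf.continuousWithinAt (fun s => heEc s x hx)
        ((continuous_apply i).comp hM'c).continuousWithinAt
    refine (h1.domRestrict.comp continuous_fst).congr fun p => ?_
    simp [hL' _ p.1.2]
  · rw [(heV x hx).injective_iff]
    simp only [hL' x hx]
    exact (heE x hx).linearIndependent_sum_smul_iff (M' x) |>.2 (hM'LI x)
  · ext1 z
    refine (heV x (hsub hx)).linearMap_ext fun i => ?_
    rw [hL' x (hsub hx), hM'M hx, hM x hx]

end Euclidean

section Restrict

variable {V : FVectorBundle.{u, v₁} 𝔽 X} {E : FVectorBundle.{u, v₂} 𝔽 X}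
  {Z : Type*} [TopologicalSpace Z]

theorem IsContinuousFamily.of_hom_restrict {A : Set X}
    (ι : Hom (V.restrict A) (E.restrict A)) :
    IsContinuousFamily (V := V) (E := E) (Z := Z) (f := fun a : A => (a : X))
      fun a _ => ι.onFiber a := by
  refine ⟨continuous_subtype_val, fun U v hU hv => ?_⟩
  have h1 : ContinuousOn (fun a : A => (⟨a, v a⟩ : (V.restrict A).Total)) {a | (a : X) ∈ U} := by
    intro a ha
    have hind : IsInducing fun p : (V.restrict A).Total => (⟨p.proj.1, p.snd⟩ : V.Total) := ⟨rfl⟩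
    rw [hind.continuousWithinAt_iff]
    exact hv.comp (s := {a : A | (a : X) ∈ U}) continuous_subtype_val.continuousOn
      (fun _ h => h) a ha
  have h2 : Continuous fun p : (E.restrict A).Total => (⟨p.proj.1, p.snd⟩ : E.Total) :=
    continuous_induced_dom
  exact ((h2.comp ι.continuous_total).comp_continuousOn h1).comp continuous_fst.continuousOn
    fun p hp => hp

theorem IsContinuousFamily.continuous_total {L : ∀ x, Z → V.Fiber x →ₗ[𝔽] E.Fiber x}
    (hL : IsContinuousFamily (f := fun x : X => x) L) (z : Z) :
    Continuous fun p : V.Total => (⟨p.proj, L p.proj z p.snd⟩ : E.Total) := by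
  rw [← continuousOn_univ]
  intro p _
  exact hL.continuousWithinAt_apply (p := fun p : V.Total => (p.proj, z)) (v := fun p => p.snd)
    (V.continuous_proj.prodMk continuous_const).continuousWithinAt continuousWithinAt_id

end Restrict

theorem exists_injective_extension [NormedAlgebra ℝ 𝔽] [FiniteDimensional ℝ 𝔽] {A : Set X}
    (K : RelCWPair A) {d : ℕ} (hd : K.DimLE d) (V : FVectorBundle.{u, v₁} 𝔽 X)
    (E : FVectorBundle.{u, v₂} 𝔽 X) (ι : Hom (V.restrict A) (E.restrict A)) (hι : ι.Injective)
    (hrank : ∀ x : X, x ∉ A → Nontrivial (V.Fiber x) →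
      d + Module.finrank ℝ 𝔽 * Module.finrank 𝔽 (V.Fiber x) <
        Module.finrank ℝ 𝔽 * (Module.finrank 𝔽 (E.Fiber x) + 1)) :
    ∃ ι' : Hom V E, ι'.Injective ∧
      ∀ (a : A) (v : V.Fiber a), ι'.onFiber a v = ι.onFiber a v := by
  -- This depends only on ranks, so its failure locus is clopen; the hypothesis places that locus
  -- inside `A`.
  let p : ℕ × ℕ → Prop := fun r => r.1 = 0 ∨
    d + Module.finrank ℝ 𝔽 * r.1 < Module.finrank ℝ 𝔽 * (r.2 + 1)
  let rk : X → ℕ × ℕ := fun x => (Module.finrank 𝔽 (V.Fiber x), Module.finrank 𝔽 (E.Fiber x))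
  have hrk : IsLocallyConstant rk := V.isLocallyConstant_finrank.prodMk E.isLocallyConstant_finrank
  have hgood : ∀ x, x ∉ A → p (rk x) := by
    intro x hx
    rcases Nat.eq_zero_or_pos (Module.finrank 𝔽 (V.Fiber x)) with h | h
    · exact Or.inl h
    · exact Or.inr (hrank x hx (Module.nontrivial_of_finrank_pos h))
  obtain ⟨L, hLc, hLinj, hLA⟩ := exists_family_extension (V := V) (E := E) (Z := Unit) K hd
    (B := rk ⁻¹' {r | ¬ p r}) ⟨⟨by rw [← preimage_compl]; exact hrk _⟩, hrk _⟩
    (fun x hx => by_contra fun h => hx (hgood x h)) (C := fun x L => Function.Injective (L ()))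
    (by
      intro n hn f hf hfB L hL hinj
      have hp := hfB 0
      simp only [mem_preimage, mem_ofPred_eq, not_not, p, rk] at hp
      exact exists_injective_extension_closedBall (hp.imp_right fun h => by omega) hf
        (fun x => finrank_fiber_eq_of_preconnected hf x 0)
        (fun x => finrank_fiber_eq_of_preconnected hf x 0) hL hinj)
    (fun a _ => ι.onFiber a) (.of_hom_restrict ι) hι
  refine ⟨⟨fun x => L x (), hLc.continuous_total ()⟩, hLinj, fun a v => ?_⟩
  change L a () v = _
  rw [hLA]
  rfl

end FVectorBundle

/-! ### Paths of isomorphisms over a disk. -/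

/-- The cylinder over a closed ball retracts onto the union of its base and its lateral boundary. -/
theorem exists_retraction_cylinder (H : Type*) [NormedAddCommGroup H] [NormedSpace ℝ H] :
    ∃ r : H × ℝ → H × ℝ, Continuous r ∧
      (∀ p ∈ Metric.closedBall 0 1 ×ˢ Icc 0 1,
        r p ∈ Metric.closedBall (0 : H) 1 ×ˢ {(0 : ℝ)} ∪ Metric.sphere 0 1 ×ˢ Icc 0 1) ∧
      ∀ p ∈ Metric.closedBall (0 : H) 1 ×ˢ {(0 : ℝ)} ∪ Metric.sphere 0 1 ×ˢ Icc 0 1, r p = p := by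
  have hp1 : ∀ p : H × ℝ, 0 < max 1 ((1 + p.2) * ‖p.1‖) := fun p => lt_max_of_lt_left one_pos
  have hp2 : ∀ p : H × ℝ, 0 < max ‖p.1‖ (1 / 2) := fun p => lt_max_of_lt_right (by norm_num)
  -- Scale `x` by `1 + t`. If it stays in the ball, land on the base; otherwise project to the
  -- sphere, at height `1 + t - 1 / ‖x‖ ≤ t`. The bound `1 / 2` only avoids division by zero:
  -- leaving the ball with `t ≤ 1` forces `‖x‖ ≥ 1 / 2`.
  refine ⟨fun p => (((1 + p.2) / max 1 ((1 + p.2) * ‖p.1‖)) • p.1,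
    max 0 ((1 + p.2) * ‖p.1‖ - 1) / max ‖p.1‖ (1 / 2)), ?_, ?_, ?_⟩
  · refine Continuous.prodMk (Continuous.smul (Continuous.div ?_ ?_ fun p => (hp1 p).ne')
      continuous_fst) (Continuous.div ?_ ?_ fun p => (hp2 p).ne')
    all_goals fun_prop
  · rintro ⟨x, t⟩ ⟨hx, ht0, ht1⟩
    simp only [mem_closedBall_zero_iff] at hx
    dsimp only at ht0 ht1 ⊢
    rcases le_total ((1 + t) * ‖x‖) 1 with h | h
    · left
      rw [max_eq_left h, max_eq_left (by linarith : (1 + t) * ‖x‖ - 1 ≤ 0)]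
      refine ⟨?_, by simp⟩
      rw [mem_closedBall_zero_iff, norm_smul, div_one, Real.norm_of_nonneg (by linarith)]
      exact h
    · right
      have hx0 : 0 < ‖x‖ := by
        by_contra h0
        have : ‖x‖ = 0 := le_antisymm (not_lt.1 h0) (norm_nonneg _)
        rw [this] at h
        linarith
      have hx2 : 1 / 2 ≤ ‖x‖ := by nlinarith
      rw [max_eq_right h, max_eq_right (by linarith : 0 ≤ (1 + t) * ‖x‖ - 1), max_eq_left hx2]
      refine ⟨?_, div_nonneg (by linarith) hx0.le, ?_⟩
      · have h1t : (0 : ℝ) < 1 + t := by linarith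
        rw [mem_sphere_zero_iff_norm, norm_smul, Real.norm_of_nonneg (by positivity)]
        field_simp
      · dsimp only
        rw [div_le_one hx0]
        nlinarith
  · rintro ⟨x, t⟩ (⟨hx, ht⟩ | ⟨hx, ht0, ht1⟩)
    · simp only [mem_closedBall_zero_iff] at hx
      obtain rfl : t = 0 := ht
      simp [hx]
    · simp only [mem_sphere_zero_iff_norm] at hx
      dsimp only at ht0 ht1
      have h1 : max 1 (1 + t) = 1 + t := max_eq_right (by linarith)
      have h2 : max (1 : ℝ) (1 / 2) = 1 := max_eq_left (by norm_num)
      have h3 : (1 + t) ≠ 0 := by linarith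
      simp only [hx, mul_one, h1, div_self h3, one_smul, h2, add_sub_cancel_left, div_one,
        max_eq_right ht0]

namespace FVectorBundle

variable {𝔽 : Type w} [NormedDivisionRing 𝔽] {X : Type u} [TopologicalSpace X]

section Euclidean

variable {V : FVectorBundle.{u, v₁} 𝔽 X} {W₁ : FVectorBundle.{u, v₂} 𝔽 X}
  {W₂ : FVectorBundle.{u, v₃} 𝔽 X}

/-- A path of linear isomorphisms starting at `Φ` and ending at an isomorphism carrying the
inclusion `a₁` to the inclusion `a₂`. -/
def IsIsoPath {x : X} (a₁ : V.Fiber x →ₗ[𝔽] W₁.Fiber x) (a₂ : V.Fiber x →ₗ[𝔽] W₂.Fiber x)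
    (Φ : W₁.Fiber x →ₗ[𝔽] W₂.Fiber x) (L : unitInterval → W₁.Fiber x →ₗ[𝔽] W₂.Fiber x) : Prop :=
  (∀ τ, Function.Bijective (L τ)) ∧ L 0 = Φ ∧ L 1 ∘ₗ a₁ = a₂

variable [NormedAlgebra ℝ 𝔽] [FiniteDimensional ℝ 𝔽]

/-- The cylinder has dimension `n + 1`, hence the extra `1` in `hdim`. First the image of `V` is
extended from base, side and top; then a complement is carried along from base and side, with no
condition at the top. -/
theorem exists_isIsoPath_extension_closedBall {n k l : ℕ}
    (hdim : k = 0 ∨ n + 1 + Module.finrank ℝ 𝔽 * k < Module.finrank ℝ 𝔽 * (l + k + 1))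
    {f : EuclideanSpace ℝ (Fin n) → X} (hf : Continuous f)
    (hV : ∀ x, Module.finrank 𝔽 (V.Fiber (f x)) = k)
    (hW₁ : ∀ x, Module.finrank 𝔽 (W₁.Fiber (f x)) = l + k)
    (hW₂ : ∀ x, Module.finrank 𝔽 (W₂.Fiber (f x)) = l + k)
    {a₁ : ∀ x, V.Fiber x →ₗ[𝔽] W₁.Fiber x} (ha₁i : ∀ x, Function.Injective (a₁ x))
    (ha₁ : Continuous fun p : V.Total => (⟨p.proj, a₁ p.proj p.snd⟩ : W₁.Total))
    {a₂ : ∀ x, V.Fiber x →ₗ[𝔽] W₂.Fiber x} (ha₂i : ∀ x, Function.Injective (a₂ x))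
    (ha₂ : Continuous fun p : V.Total => (⟨p.proj, a₂ p.proj p.snd⟩ : W₂.Total))
    {Φ : ∀ x, W₁.Fiber x →ₗ[𝔽] W₂.Fiber x} (hΦb : ∀ x, Function.Bijective (Φ x))
    (hΦ : Continuous fun p : W₁.Total => (⟨p.proj, Φ p.proj p.snd⟩ : W₂.Total))
    {L : ∀ x, unitInterval → W₁.Fiber (f x) →ₗ[𝔽] W₂.Fiber (f x)}
    (hL : IsContinuousFamily (T := Metric.sphere (0 : EuclideanSpace ℝ (Fin n)) 1)
      (f := fun t => f t) fun t => L t)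
    (hpath : ∀ x ∈ Metric.sphere 0 1, IsIsoPath (a₁ (f x)) (a₂ (f x)) (Φ (f x)) (L x)) :
    ∃ L' : ∀ x, unitInterval → W₁.Fiber (f x) →ₗ[𝔽] W₂.Fiber (f x),
      IsContinuousFamily (T := Metric.closedBall (0 : EuclideanSpace ℝ (Fin n)) 1)
        (f := fun t => f t) (fun t => L' t) ∧
      (∀ x ∈ Metric.closedBall 0 1, IsIsoPath (a₁ (f x)) (a₂ (f x)) (Φ (f x)) (L' x)) ∧
      ∀ x ∈ Metric.sphere 0 1, L' x = L x := by
  let H := EuclideanSpace ℝ (Fin n)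
  let D : Set H := Metric.closedBall 0 1
  let S : Set H := Metric.sphere 0 1
  have hSD : S ⊆ D := Metric.sphere_subset_closedBall
  let F : H × ℝ → X := fun p => f p.1
  have hF : Continuous F := hf.comp continuous_fst
  let Q : Set (H × ℝ) := D ×ˢ Icc 0 1
  let A₀ : Set (H × ℝ) := D ×ˢ {0} ∪ S ×ˢ Icc 0 1
  let A₁ : Set (H × ℝ) := A₀ ∪ D ×ˢ {1}
  have hDc : IsCompact D := isCompact_closedBall 0 1
  have hSc : IsCompact S := isCompact_sphere 0 1
  have hQc : IsCompact Q := hDc.prod isCompact_Icc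
  have hA₁c : IsCompact A₁ := ((hDc.prod isCompact_singleton).union
    (hSc.prod isCompact_Icc)).union (hDc.prod isCompact_singleton)
  have hA₁Q : A₁ ⊆ Q := by
    rintro ⟨x, t⟩ ((⟨hx, ht⟩ | ⟨hx, ht⟩) | ⟨hx, ht⟩)
    · obtain rfl : t = 0 := ht
      exact ⟨hx, by simp⟩
    · exact ⟨hSD hx, ht⟩
    · obtain rfl : t = 1 := ht
      exact ⟨hx, by simp⟩
  have hA₀Q : A₀ ⊆ Q := subset_union_left.trans hA₁Q
  obtain ⟨Λ, a, b, hbox⟩ := hDc.exists_subset_box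
  obtain ⟨Λ', a', b', hbox'⟩ := hQc.exists_subset_box
  obtain ⟨ν, hνc, hν⟩ := exists_frame_box Λ hf a b hV
  have hν₁c : ∀ i, ContinuousOn (fun x => (⟨f x, a₁ (f x) (ν x i)⟩ : W₁.Total))
      (Λ ⁻¹' Icc a b) := fun i => ha₁.comp_continuousOn (hνc i)
  obtain ⟨ε, hεc, hε⟩ := hasCompletion_box (W := W₁) (j := fun x i => a₁ (f x) (ν x i)) Λ hf a b
    hν₁c (fun x hx => ((hν x hx).injective_iff _).1 (ha₁i _))
    (k := l) (fun x _ => by rw [hW₁, Fintype.card_fin])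
  obtain ⟨ω, hωc, hω⟩ := exists_frame_box (W := W₂) Λ' hF a' b' (fun p => hW₂ p.1)
  replace hν := fun x hx => hν x (hbox hx)
  replace hνc := fun i => (hνc i).mono hbox
  replace hε := fun x hx => hε x (hbox hx)
  replace hεc := fun i => (hεc i).mono hbox
  replace hν₁c := fun i => (hν₁c i).mono hbox
  let pI : ℝ → unitInterval := projIcc 0 1 zero_le_one
  have hpI : Continuous pI := continuous_projIcc
  -- The isomorphism prescribed on `A₀`: `Φ` on the base and the given path on the side. They agree
  -- on the common edge since paths start at `Φ`.
  let G : ∀ p : H × ℝ, W₁.Fiber (F p) →ₗ[𝔽] W₂.Fiber (F p) := fun p =>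
    if p.2 ≤ 0 then Φ (f p.1) else L p.1 (pI p.2)
  have hG0 : ∀ x ∈ D, G (x, 0) = Φ (f x) := fun x _ => by simp [G]
  have hGS : ∀ x ∈ S, ∀ τ : unitInterval, G (x, τ) = L x τ := by
    intro x hx τ
    by_cases h : (τ : ℝ) ≤ 0
    · obtain rfl : τ = 0 := le_antisymm h τ.2.1
      simp [G, (hpath x hx).2.1]
    · simp [G, h, pI]
  have hGS' : ∀ p ∈ S ×ˢ Icc (0 : ℝ) 1, G p = L p.1 (pI p.2) := by
    rintro ⟨x, t⟩ ⟨hx, ht⟩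
    have h := hGS x hx ⟨t, ht⟩
    rw [show pI t = ⟨t, ht⟩ from projIcc_of_mem zero_le_one ht]
    exact h
  have hGb : ∀ p ∈ A₀, Function.Bijective (G p) := by
    rintro ⟨x, t⟩ (⟨hx, ht⟩ | hp)
    · obtain rfl : t = 0 := ht
      rw [hG0 x hx]
      exact hΦb _
    · rw [hGS' _ hp]
      exact (hpath x hp.1).1 _
  have hGc : ∀ σ : ∀ x, W₁.Fiber (f x), ContinuousOn (fun x => (⟨f x, σ x⟩ : W₁.Total)) D →
      ContinuousOn (fun p => (⟨F p, G p (σ p.1)⟩ : W₂.Total)) A₀ := by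
    intro σ hσ
    refine ContinuousOn.union_of_isClosed ?_ ?_ (hDc.isClosed.prod isClosed_singleton)
      (hSc.isClosed.prod isClosed_Icc)
    · refine ((hΦ.comp_continuousOn hσ).comp (s := D ×ˢ {(0 : ℝ)}) continuousOn_fst
        fun p hp => hp.1).congr ?_
      rintro ⟨x, t⟩ ⟨hx, ht⟩
      obtain rfl : t = 0 := ht
      simp only [hG0 x hx]
      rfl
    · refine (hL.continuousOn_apply (R := S ×ˢ Icc (0 : ℝ) 1) (g := fun p => p.1)
        (τ := fun p => pI p.2) (σ := fun p => σ p.1) continuousOn_fst (fun p hp => hp.1)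
        (hpI.comp continuous_snd).continuousOn
        (hσ.comp continuousOn_fst fun p hp => hSD hp.1)).congr ?_
      intro p hp
      simp only [hGS' p hp, F]
  -- The injection prescribed on `A₁`: `G ∘ a₁` on base and side, `a₂` on the top. These agree on
  -- the top edge because the boundary paths end by carrying `a₁` to `a₂`.
  let N : ∀ p : H × ℝ, V.Fiber (F p) →ₗ[𝔽] W₂.Fiber (F p) := fun p =>
    if 1 ≤ p.2 then a₂ (f p.1) else G p ∘ₗ a₁ (f p.1)
  have hN1 : ∀ x ∈ D, N (x, 1) = a₂ (f x) := fun x _ => by simp [N]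
  have hN0 : ∀ p ∈ A₀, N p = G p ∘ₗ a₁ (f p.1) := by
    intro p hp
    by_cases h : 1 ≤ p.2
    · obtain ⟨x, t⟩ := p
      rcases hp with ⟨hx, ht⟩ | ⟨hx, ht⟩
      · obtain rfl : t = 0 := ht
        norm_num at h
      · obtain rfl : t = 1 := le_antisymm ht.2 h
        rw [hN1 x (hSD hx)]
        have := hGS x hx 1
        simp only [Icc.coe_one] at this
        rw [this]
        exact (hpath x hx).2.2.symm
    · simp [N, h]
  have hNi : ∀ p ∈ A₁, Function.Injective (N p) := by
    rintro ⟨x, t⟩ (hp | ⟨hx, ht⟩)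
    · rw [hN0 _ hp]
      exact (hGb _ hp).1.comp (ha₁i _)
    · obtain rfl : t = 1 := ht
      rw [hN1 x hx]
      exact ha₂i _
  have hNc : ∀ i, ContinuousOn (fun p => (⟨F p, N p (ν p.1 i)⟩ : W₂.Total)) A₁ := by
    intro i
    refine ContinuousOn.union_of_isClosed ?_ ?_ ((hDc.isClosed.prod isClosed_singleton).union
      (hSc.isClosed.prod isClosed_Icc)) (hDc.isClosed.prod isClosed_singleton)
    · refine (hGc (fun x => a₁ (f x) (ν x i)) (hν₁c i)).congr fun p hp => ?_
      simp only [hN0 p hp]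
      rfl
    · refine ((ha₂.comp_continuousOn (hνc i)).comp (s := D ×ˢ {(1 : ℝ)}) continuousOn_fst
        fun p hp => hp.1).congr ?_
      rintro ⟨x, t⟩ ⟨hx, ht⟩
      obtain rfl : t = 1 := ht
      simp only [hN1 x hx]
      rfl
  have hA₁box := hA₁Q.trans hbox'
  obtain ⟨M, hMc, hM⟩ := exists_continuousOn_coeff (W := W₂) hF (fun s => (hωc s).mono hA₁box)
    (fun p hp => hω p (hA₁box hp)) hNc
  have hMLI : ∀ p ∈ A₁, LinearIndependent 𝔽 (M p) := by
    intro p hp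
    rw [← (hω p (hA₁box hp)).linearIndependent_sum_smul_iff]
    simp only [hM p hp]
    exact ((hν p.1 (hA₁Q hp).1).injective_iff _).1 (hNi p hp)
  obtain ⟨M', hM'c, hM'M, hM'LI⟩ := exists_extension_linearIndependent
    (by simpa [H, Module.finrank_prod] using hdim) hA₁c hMc hMLI
  let J : ∀ p : H × ℝ, Fin k → W₂.Fiber (F p) := fun p i => ∑ s, M' p i s • ω p s
  have hJN : ∀ p ∈ A₁, ∀ i, J p i = N p (ν p.1 i) := by
    intro p hp i
    simp only [J, hM'M hp, hM p hp]
  have hJc : ∀ i, ContinuousOn (fun p => (⟨F p, J p i⟩ : W₂.Total)) (Λ' ⁻¹' Icc a' b') :=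
    fun i p hp => continuousWithinAt_sum hF.continuousWithinAt (fun s => hωc s p hp)
      ((continuous_apply i).comp hM'c).continuousWithinAt
  have hcompl : HasCompletion W₂ F J l Q := (hasCompletion_box Λ' hF a' b' hJc
    (fun p hp => ((hω p hp).linearIndependent_sum_smul_iff (M' p)).2 (hM'LI p))
    (fun p _ => by rw [Fintype.card_fin]; exact hW₂ p.1)).mono hbox'
  replace hJc := fun i => (hJc i).mono hbox'
  obtain ⟨r, hrc, hrQ, hrA⟩ := exists_retraction_cylinder H
  have hεν : ∀ p ∈ A₀, IsFrame (𝔽 := 𝔽) (Sum.elim (fun i => G p (ε p.1 i)) (J p)) := by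
    intro p hp
    have h1 := (hε p.1 (hA₀Q hp).1).map_bijective (hGb p hp)
    convert h1 using 1
    ext i
    rcases i with i | i
    · rfl
    · simp only [Sum.elim_inr]
      rw [hJN p (Or.inl hp), hN0 p hp]
      rfl
  -- A complement of the image `J` of `V` exists over the cylinder; the retraction onto `A₀` allows
  -- it to restrict there to the image under `G` of the complement `ε`.
  obtain ⟨ψ, hψc, hψ, hψG⟩ := hcompl.exists_extension hA₀Q hF hJc hrc.continuousOn hrQ hrA
    (ψ₀ := fun p i => G p (ε p.1 i)) (fun i => hGc _ (hεc i)) hεν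
  have hL' : ∀ x : H, ∀ τ : unitInterval, ∃ L' : W₁.Fiber (f x) →ₗ[𝔽] W₂.Fiber (f x), x ∈ D →
      ∀ i, L' (Sum.elim (ε x) (fun i => a₁ (f x) (ν x i)) i) =
        Sum.elim (ψ (x, τ)) (J (x, τ)) i := by
    intro x τ
    by_cases hx : x ∈ D
    · obtain ⟨L', hL'⟩ := (hε x hx).exists_linearMap (Sum.elim (ψ (x, τ)) (J (x, τ)))
      exact ⟨L', fun _ => hL'⟩
    · exact ⟨0, fun h => absurd h hx⟩
  choose L' hL' using hL'
  have hL'G : ∀ x ∈ D, ∀ τ : unitInterval, (x, (τ : ℝ)) ∈ A₀ → L' x τ = G (x, τ) := by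
    intro x hx τ hp
    refine (hε x hx).linearMap_ext fun i => ?_
    rw [hL' x τ hx]
    rcases i with i | i
    · simp only [Sum.elim_inl, hψG _ hp]
    · simp only [Sum.elim_inr, hJN _ (Or.inl hp), hN0 _ hp]
      rfl
  refine ⟨L', ?_, fun x hx => ⟨fun τ => ?_, ?_, ?_⟩, fun x hx => ?_⟩
  · refine IsContinuousFamily.of_frame (hf.comp continuous_subtype_val)
      (e := fun t => Sum.elim (ε t) (fun i => a₁ (f t) (ν t i))) ?_ (fun t => hε t t.2) fun i => ?_
    · rintro (i | i)
      · exact (hεc i).domRestrict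
      · exact (hν₁c i).domRestrict
    · have h1 : ContinuousOn (fun p => (⟨F p, Sum.elim (ψ p) (J p) i⟩ : W₂.Total)) Q := by
        rcases i with i | i
        · exact hψc i
        · exact hJc i
      have h2 : Continuous fun p : D × unitInterval => ((p.1 : H), (p.2 : ℝ)) := by fun_prop
      refine (h1.comp_continuous h2 fun p => ⟨p.1.2, p.2.2⟩).congr fun p => ?_
      simp only [hL' _ p.2 p.1.2]
      rfl
  · refine (hε x hx).bijective_of_map ?_
    simp only [hL' x τ hx]
    exact hψ _ ⟨hx, τ.2⟩
  · rw [hL'G x hx 0 (Or.inl ⟨hx, rfl⟩)]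
    exact hG0 x hx
  · refine (hν x hx).linearMap_ext fun i => ?_
    have h1 := hL' x 1 hx (Sum.inr i)
    have h2 := hJN (x, 1) (Or.inr ⟨hx, rfl⟩) i
    rw [hN1 x hx] at h2
    exact h1.trans h2
  · ext1 τ
    rw [hL'G x (hSD hx) τ (Or.inr ⟨hx, τ.2⟩), hGS x hx τ]

end Euclidean

end FVectorBundle

/-! ### Cancelling the common summand. -/

namespace FVectorBundle

variable {𝔽 : Type w} [NormedDivisionRing 𝔽] {X : Type u} [TopologicalSpace X]

section Isomorphisms

variable [NormedAlgebra ℝ 𝔽] [FiniteDimensional ℝ 𝔽] {V : FVectorBundle.{u, v₁} 𝔽 X}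
  {E : FVectorBundle.{u, v₂} 𝔽 X}

/-- For a local frame `e`, the coefficients of the inverse image in `e` are those of the given
vector in the frame `h e`, which are continuous. -/
theorem Hom.continuous_symm (h : Hom V E) (hb : ∀ x, Function.Bijective (h.onFiber x)) :
    Continuous fun p : E.Total =>
      (⟨p.proj, (LinearEquiv.ofBijective _ (hb p.proj)).symm p.snd⟩ : V.Total) := by
  classical
  rw [continuous_iff_continuousAt]
  intro p
  obtain ⟨C, hC⟩ := V.exists_localChart p.proj
  let e : ∀ x, Fin C.n → V.Fiber x := fun x i => C.ψ x (Pi.single i 1)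
  have hecoord : ∀ x (a : Fin C.n → 𝔽), C.ψ x a = ∑ i, a i • e x i := by
    intro x a
    conv_lhs => rw [pi_eq_sum_univ' a]
    simp only [map_sum, map_smul, e]
  let S : Set E.Total := {p | p.proj ∈ C.U}
  have hS : IsOpen S := C.isOpen.preimage E.continuous_proj
  have hec : ∀ i, ContinuousOn (fun p : E.Total => (⟨p.proj, e p.proj i⟩ : V.Total)) S := fun i =>
    C.continuousOn_ψ.comp (f := fun p : E.Total => (p.proj, (Pi.single i 1 : Fin C.n → 𝔽)))
      (E.continuous_proj.prodMk continuous_const).continuousOn fun p hp => hp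
  have hframe : ∀ x ∈ C.U, IsFrame (𝔽 := 𝔽) (e x) := by
    intro x hx
    have h1 : Function.Bijective (C.ψ x) :=
      Function.bijective_iff_has_inverse.2 ⟨C.φ x, C.φ_ψ x hx, C.ψ_φ x hx⟩
    let b := (Pi.basisFun 𝔽 (Fin C.n))
    have h2 : IsFrame (𝔽 := 𝔽) (b : Fin C.n → Fin C.n → 𝔽) := ⟨b.linearIndependent, b.span_eq.ge⟩
    simpa [e, b] using h2.map_bijective h1
  let g : ∀ x, E.Fiber x → V.Fiber x := fun x => (LinearEquiv.ofBijective _ (hb x)).symm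
  have hg : ∀ x y, h.onFiber x (g x y) = y := fun x y =>
    (LinearEquiv.ofBijective _ (hb x)).apply_symm_apply y
  let a : E.Total → Fin C.n → 𝔽 := fun p => C.φ p.proj (g p.proj p.snd)
  have hsum : ∀ p ∈ S, ∑ i, a p i • e p.proj i = g p.proj p.snd := fun p hp => by
    rw [← hecoord]
    exact C.ψ_φ _ hp _
  have ha : ContinuousWithinAt a S p := by
    refine continuousWithinAt_coeff (E := E) (f := fun p : E.Total => p.proj)
      E.continuous_proj.continuousWithinAt (e := fun p i => h.onFiber p.proj (e p.proj i))
      (fun i => h.continuous_total.continuousAt.comp_continuousWithinAt (hec i p hC))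
      ((hframe _ hC).map_bijective (hb _)) (σ := fun p => p.snd) continuousWithinAt_id hC ?_
    intro p hp
    rw [← hg p.proj p.snd, ← hsum p hp]
    simp only [map_sum, map_smul]
  have h1 := continuousWithinAt_sum (E := V) (f := fun p : E.Total => p.proj)
    E.continuous_proj.continuousWithinAt (fun i => hec i p hC) ha
  refine (h1.continuousAt (hS.mem_nhds hC)).congr ?_
  filter_upwards [hS.mem_nhds hC] with q hq
  rw [hsum q hq]

/-- A bundle map that is bijective on fibres is an isomorphism. -/
def Hom.toIso (h : Hom V E) (hb : ∀ x, Function.Bijective (h.onFiber x)) : Iso V E where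
  onFiber x := LinearEquiv.ofBijective _ (hb x)
  continuous_total := h.continuous_total
  continuous_total_symm := h.continuous_symm hb

end Isomorphisms

section DirectSum

variable (V : FVectorBundle.{u, v₁} 𝔽 X) (E : FVectorBundle.{u, v₂} 𝔽 X)

theorem isInducing_directSum :
    IsInducing fun p : (E.directSum V).Total =>
      ((⟨p.proj, p.snd.1⟩, ⟨p.proj, p.snd.2⟩) : E.Total × V.Total) := ⟨rfl⟩

theorem continuous_directSum_fst :
    Continuous fun p : (E.directSum V).Total => (⟨p.proj, p.snd.1⟩ : E.Total) :=
  continuous_fst.comp (isInducing_directSum V E).continuous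

theorem continuous_zero : Continuous fun x : X => (⟨x, 0⟩ : E.Total) := by
  rw [← continuousOn_univ]
  exact fun x _ => continuousWithinAt_zero continuousWithinAt_id

theorem continuous_directSum_inl :
    Continuous fun p : E.Total => (⟨p.proj, (p.snd, 0)⟩ : (E.directSum V).Total) :=
  (isInducing_directSum V E).continuous_iff.2
    (continuous_id.prodMk (V.continuous_zero.comp E.continuous_proj))

theorem continuous_directSum_inr :
    Continuous fun p : V.Total => (⟨p.proj, (0, p.snd)⟩ : (E.directSum V).Total) :=
  (isInducing_directSum V E).continuous_iff.2
    ((E.continuous_zero.comp V.continuous_proj).prodMk continuous_id)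

theorem finrank_directSum (x : X) :
    Module.finrank 𝔽 ((E.directSum V).Fiber x) =
      Module.finrank 𝔽 (E.Fiber x) + Module.finrank 𝔽 (V.Fiber x) :=
  Module.finrank_prod

end DirectSum

/-- `L` is the identity on the summand `N`, so this is the isomorphism it induces on the quotients
by `N`. `L` need not preserve the complements. -/
theorem bijective_fst_comp_inl {𝕜 M M' N : Type*} [DivisionRing 𝕜] [AddCommGroup M] [Module 𝕜 M]
    [AddCommGroup M'] [Module 𝕜 M'] [AddCommGroup N] [Module 𝕜 N] {L : M × N →ₗ[𝕜] M' × N}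
    (hL : Function.Bijective L) (h : ∀ v, L (0, v) = (0, v)) :
    Function.Bijective (LinearMap.fst 𝕜 M' N ∘ₗ L ∘ₗ LinearMap.inl 𝕜 M N) := by
  constructor
  · rw [injective_iff_map_eq_zero]
    intro m hm
    have h1 : L (m, 0) = L (0, (L (m, 0)).2) := by
      rw [h]
      exact Prod.ext hm rfl
    exact congrArg Prod.fst (hL.1 h1)
  · intro m'
    obtain ⟨⟨m, v⟩, hmv⟩ := hL.2 (m', 0)
    refine ⟨m, ?_⟩
    have h1 : L (m, 0) = L (m, v) - L (0, v) := by
      rw [← map_sub]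
      simp
    change (L (m, 0)).1 = m'
    rw [h1, hmv, h]
    simp

theorem exists_iso_extension_of_directSum [NormedAlgebra ℝ 𝔽] [FiniteDimensional ℝ 𝔽] {A : Set X}
    (K : RelCWPair A) {d : ℕ} (hd : K.DimLE d) (V : FVectorBundle.{u, v₁} 𝔽 X)
    (E₁ : FVectorBundle.{u, v₂} 𝔽 X) (E₂ : FVectorBundle.{u, v₃} 𝔽 X)
    (φA : Iso (E₁.restrict A) (E₂.restrict A)) (φV : Iso (E₁.directSum V) (E₂.directSum V))
    (hφ : ∀ (a : A) (e : E₁.Fiber a) (v : V.Fiber a),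
      φV.onFiber a (e, v) = (φA.onFiber a e, v))
    (hrank : ∀ x : X, x ∉ A → Nontrivial (V.Fiber x) →
      d + 1 < Module.finrank ℝ 𝔽 * (Module.finrank 𝔽 (E₁.Fiber x) + 1)) :
    ∃ φ : Iso E₁ E₂, ∀ (a : A) (e : E₁.Fiber a), φ.onFiber a e = φA.onFiber a e := by
  let p : ℕ × ℕ → Prop := fun r => r.1 = 0 ∨ d + 1 < Module.finrank ℝ 𝔽 * (r.2 + 1)
  let rk : X → ℕ × ℕ := fun x => (Module.finrank 𝔽 (V.Fiber x), Module.finrank 𝔽 (E₁.Fiber x))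
  have hrk : IsLocallyConstant rk :=
    V.isLocallyConstant_finrank.prodMk E₁.isLocallyConstant_finrank
  have hgood : ∀ x, x ∉ A → p (rk x) := by
    intro x hx
    rcases Nat.eq_zero_or_pos (Module.finrank 𝔽 (V.Fiber x)) with h | h
    · exact Or.inl h
    · exact Or.inr (hrank x hx (Module.nontrivial_of_finrank_pos h))
  let a₁ : ∀ x, V.Fiber x →ₗ[𝔽] (E₁.directSum V).Fiber x := fun x => LinearMap.inr 𝔽 _ _
  let a₂ : ∀ x, V.Fiber x →ₗ[𝔽] (E₂.directSum V).Fiber x := fun x => LinearMap.inr 𝔽 _ _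
  let Φ : ∀ x, (E₁.directSum V).Fiber x →ₗ[𝔽] (E₂.directSum V).Fiber x := fun x => φV.onFiber x
  have hΦ : ∀ a : A, ∀ (e : E₁.Fiber a) (v : V.Fiber a), Φ a (e, v) = (φA.onFiber a e, v) := hφ
  have hW₂ : ∀ x, Module.finrank 𝔽 ((E₂.directSum V).Fiber x) =
      Module.finrank 𝔽 (E₁.Fiber x) + Module.finrank 𝔽 (V.Fiber x) := fun x => by
    rw [← (φV.onFiber x).finrank_eq, finrank_directSum]
  obtain ⟨L, hLc, hLp, hLA⟩ := exists_family_extension (V := E₁.directSum V)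
    (E := E₂.directSum V) (Z := unitInterval) K hd (B := rk ⁻¹' {r | ¬ p r})
    ⟨⟨by rw [← preimage_compl]; exact hrk _⟩, hrk _⟩ (fun x hx => by_contra fun h => hx (hgood x h))
    (C := fun x L => IsIsoPath (a₁ x) (a₂ x) (Φ x) L)
    (by
      intro n hn f hf hfB L hL hpath
      have hp := hfB 0
      simp only [mem_preimage, mem_ofPred_eq, not_not, p, rk] at hp
      have hV := fun x => finrank_fiber_eq_of_preconnected (V := V) hf x 0
      have hE := fun x => finrank_fiber_eq_of_preconnected (V := E₁) hf x 0
      refine exists_isIsoPath_extension_closedBall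
        (l := Module.finrank 𝔽 (E₁.Fiber (f 0))) (hp.imp_right fun h => ?_) hf hV
        (fun x => ?_) (fun x => ?_)
        (fun x => LinearMap.inr_injective) (continuous_directSum_inr V E₁)
        (fun x => LinearMap.inr_injective) (continuous_directSum_inr V E₂)
        (fun x => (φV.onFiber (x : X)).bijective) φV.continuous_total hL hpath
      · simp only [mul_add, mul_one] at h ⊢
        omega
      · rw [finrank_directSum, hV, hE]
      · rw [hW₂, hV, hE])
    -- Over `A` the constant path works, since `φV` already fixes `V` there. Its endpoint restricts
    -- to `φA`.
    (fun a _ => Φ a) ((IsContinuousFamily.of_hom φV.continuous_total).comp continuous_subtype_val)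
    (fun a => ⟨fun _ => (φV.onFiber (a : X)).bijective, rfl, LinearMap.ext fun v => by
      change Φ a (0, v) = (0, v)
      exact (hΦ a 0 v).trans (congrArg (·, v) (map_zero (φA.onFiber a)))⟩)
  have hL1 := hLc.continuous_total 1
  let φ : Hom E₁ E₂ :=
    { onFiber := fun x => LinearMap.fst 𝔽 (E₂.Fiber x) (V.Fiber x) ∘ₗ L x 1 ∘ₗ
        LinearMap.inl 𝔽 (E₁.Fiber x) (V.Fiber x)
      continuous_total := (continuous_directSum_fst V E₂).comp
        (hL1.comp (continuous_directSum_inl V E₁)) }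
  refine ⟨φ.toIso fun x => bijective_fst_comp_inl ((hLp x).1 1)
    fun v => LinearMap.congr_fun (hLp x).2.2 v, fun a e => ?_⟩
  change (L a 1 (e, 0)).1 = _
  rw [hLA]
  change (Φ a (e, 0)).1 = _
  rw [hΦ]

theorem rank_lt_of_ceil_le {c d m k : ℕ} (hc : 0 < c)
    (h : (m : ℤ) ≥ k + ⌈((d : ℚ) + 1 - c) / c⌉) : d + c * k < c * (m + 1) := by
  have hc' : (0 : ℚ) < c := by exact_mod_cast hc
  have h1 : ⌈((d : ℚ) + 1 - c) / c⌉ ≤ (m : ℤ) - k := by linarith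
  rw [Int.ceil_le, div_le_iff₀ hc'] at h1
  push_cast at h1
  have h2 : ((d + c * k : ℕ) : ℚ) < (c * (m + 1) : ℕ) := by
    push_cast
    linarith
  exact_mod_cast h2

end FVectorBundle

end

theorem corollary5p1 {𝔽 : Type w} [NormedDivisionRing 𝔽] [NormedAlgebra ℝ 𝔽]
    [FiniteDimensional ℝ 𝔽] (c : ℕ) (hc : c = Module.finrank ℝ 𝔽)
    {X : Type u} [TopologicalSpace X] {A : Set X} (K : RelCWPair A) (d : ℕ) (hd : K.DimLE d) :
    (∀ (V : FVectorBundle.{u, v₁} 𝔽 X) (E : FVectorBundle.{u, v₂} 𝔽 X)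
        (ι : FVectorBundle.Hom (V.restrict A) (E.restrict A)),
        ι.Injective →
        (∀ x : X, x ∉ A → Nontrivial (V.Fiber x) →
          (Module.finrank 𝔽 (E.Fiber x) : ℤ) ≥
            Module.finrank 𝔽 (V.Fiber x) + ⌈((d : ℚ) + 1 - c) / c⌉) →
        ∃ ι' : FVectorBundle.Hom V E, ι'.Injective ∧
          ∀ (a : A) (v : V.Fiber a), ι'.onFiber a v = ι.onFiber a v) ∧
    (∀ (V : FVectorBundle.{u, v₁} 𝔽 X) (E₁ : FVectorBundle.{u, v₂} 𝔽 X)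
        (E₂ : FVectorBundle.{u, v₃} 𝔽 X)
        (φA : FVectorBundle.Iso (E₁.restrict A) (E₂.restrict A))
        (φV : FVectorBundle.Iso (E₁.directSum V) (E₂.directSum V)),
        (∀ (a : A) (e : E₁.Fiber a) (v : V.Fiber a),
          φV.onFiber a (e, v) = (φA.onFiber a e, v)) →
        (∀ x : X, x ∉ A → Nontrivial (V.Fiber x) →
          (Module.finrank 𝔽 (E₁.Fiber x) : ℤ) ≥ ⌈((d : ℚ) + 2 - c) / c⌉) →
        ∃ φ : FVectorBundle.Iso E₁ E₂,
          ∀ (a : A) (e : E₁.Fiber a), φ.onFiber a e = φA.onFiber a e) := by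
  subst hc
  have hc : 0 < Module.finrank ℝ 𝔽 := Module.finrank_pos
  refine ⟨fun V E ι hι hrank => FVectorBundle.exists_injective_extension K hd V E ι hι
    fun x hx hV => FVectorBundle.rank_lt_of_ceil_le hc (hrank x hx hV),
    fun V E₁ E₂ φA φV hφ hrank => FVectorBundle.exists_iso_extension_of_directSum K hd V E₁ E₂
      φA φV hφ fun x hx hV => ?_⟩
  -- The inequality for (2) is the one for (1) with `d + 1` in place of `d`, because of the
  -- cylinder; the rank of `V` cancels, hence `k = 0`.
  have h := FVectorBundle.rank_lt_of_ceil_le (d := d + 1) (k := 0) hc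
    (m := Module.finrank 𝔽 (E₁.Fiber x)) (by
      have h1 := hrank x hx hV
      push_cast
      rwa [zero_add, add_assoc, one_add_one_eq_two])
  simpa using h
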